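/- Let $n, m \ge 1$. For $k \ge 0$ let $C_k$ be the (symmetric, uncoloured, topological) operad of little $k$-cubes: $C_k(j)$ is the space of $j$-tuples of rectilinear embeddings $x \mapsto a + \operatorname{diag}(d_1,\dots,d_k)\,x$ (all $d_i > 0$) of the open unit cube $]0,1[^k$ into itself with pairwise disjoint images; in particular $C_k(0)$ is a point. Let $C_n \otimes C_m$ be the Boardman--Vogt tensor product, i.e. the topological operad generated by operations $p \otimes 1$ ($p \in C_n(a)$, $a \ge 0$) and $1 \otimes q$ ($q \in C_m(b)$, $b \ge 0$), subject to the relations that $p \mapsto p \otimes 1$ and $q \mapsto 1 \otimes q$ are morphisms of topological operads and to the interchange relation $$(p \otimes 1) \circ (1 \otimes q, \dots, 1 \otimes q) = \bigl[(1 \otimes q) \circ (p \otimes 1, \dots, p \otimes 1)\bigr] \cdot \tau_{a,b},$$ where $\tau_{a,b}$ is the permutation of the $ab$ inputs that exchanges row and column indices. Let $\mu \colon C_n \otimes C_m \to C_{n+m}$ be the morphism of topological operads such that $\mu(p \otimes 1)$ is obtained from $p$ by multiplying each little cube with $]0,1[^m$, and $\mu(1 \otimes q)$ is obtained from $q$ by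 multiplying $]0,1[^n$ with each little cube. Let $C_n | C_m \subseteq C_{n+m}$ be the image of $\mu$, a suboperad with the subspace topologies, and let $\mu' \colon C_n \otimes C_m \to C_n | C_m$ be the morphism through which $\mu$ factors. Then for every arity $j \ge 1$ the map $\mu' \colon (C_n \otimes C_m)(j) \to (C_n | C_m)(j)$ is a continuous bijection. -/

import Mathlib

universe u

/-- A symmetric operad in sets. `Op k` is the set of operations of arity `k`, `relabel` is the
action of bijections of inputs (for `k = l` this is the action of the symmetric group), and
`comp e p q` is the operadic composite `p ∘ (q₁, …, q_k)`, in which the input `x` of `q i` becomes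
the input `e ⟨i, x⟩` of the composite. The usual composition, which orders the inputs block by
block, is `comp finSigmaFinEquiv`; by `relabel_comp` every `comp e` is a relabelling of it. -/
structure SymOperad where
  Op : ℕ → Type u
  one : Op 1
  relabel : ∀ {k l : ℕ}, (Fin k ≃ Fin l) → Op k → Op l
  comp : ∀ {k l : ℕ} {a : Fin k → ℕ}, ((Σ i, Fin (a i)) ≃ Fin l) →
    Op k → (∀ i, Op (a i)) → Op l
  relabel_refl : ∀ {k : ℕ} (p : Op k), relabel (Equiv.refl _) p = p
  relabel_relabel : ∀ {k l r : ℕ} (σ : Fin k ≃ Fin l) (τ : Fin l ≃ Fin r) (p : Op k),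
    relabel τ (relabel σ p) = relabel (σ.trans τ) p
  relabel_comp : ∀ {k l r : ℕ} {a : Fin k → ℕ} (e : (Σ i, Fin (a i)) ≃ Fin l) (σ : Fin l ≃ Fin r)
    (p : Op k) (q : ∀ i, Op (a i)), relabel σ (comp e p q) = comp (e.trans σ) p q
  comp_relabel_left : ∀ {k l r : ℕ} {a : Fin l → ℕ} (σ : Fin k ≃ Fin l)
    (e : (Σ i, Fin (a i)) ≃ Fin r) (p : Op k) (q : ∀ i, Op (a i)),
    comp e (relabel σ p) q = comp ((Equiv.sigmaCongrLeft σ).trans e) p (fun i => q (σ i))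
  comp_relabel_right : ∀ {k l : ℕ} {a b : Fin k → ℕ} (σ : ∀ i, Fin (a i) ≃ Fin (b i))
    (e : (Σ i, Fin (b i)) ≃ Fin l) (p : Op k) (q : ∀ i, Op (a i)),
    comp e p (fun i => relabel (σ i) (q i)) = comp ((Equiv.sigmaCongrRight σ).trans e) p q
  one_comp : ∀ {k l : ℕ} (e : (Σ _ : Fin 1, Fin k) ≃ Fin l) (q : Op k),
    comp e one (fun _ => q) = relabel ((Equiv.uniqueSigma fun _ : Fin 1 => Fin k).symm.trans e) q
  comp_one : ∀ {k l : ℕ} (e : (Σ _ : Fin k, Fin 1) ≃ Fin l) (p : Op k),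
    comp e p (fun _ => one) = relabel ((Equiv.sigmaUnique (Fin k) fun _ => Fin 1).symm.trans e) p
  assoc : ∀ {k l r : ℕ} {a : Fin k → ℕ} {b : Fin l → ℕ} {c : Fin k → ℕ}
    (e : (Σ i, Fin (a i)) ≃ Fin l) (f : ∀ i, (Σ x : Fin (a i), Fin (b (e ⟨i, x⟩))) ≃ Fin (c i))
    (g : (Σ i, Fin (c i)) ≃ Fin r) (p : Op k) (q : ∀ i, Op (a i)) (s : ∀ x, Op (b x)),
    comp g p (fun i => comp (f i) (q i) (fun x => s (e ⟨i, x⟩))) =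
      comp ((Equiv.sigmaCongrLeft e).symm.trans ((Equiv.sigmaAssoc _).trans
        ((Equiv.sigmaCongrRight f).trans g))) (comp e p q) s

namespace SymOperad

/-- Topologies on the sets of operations make all structure maps of the operad continuous. -/
structure IsTopologized (O : SymOperad.{u}) (τ : ∀ j, TopologicalSpace (O.Op j)) : Prop where
  continuous_relabel : ∀ {k l : ℕ} (σ : Fin k ≃ Fin l), Continuous (O.relabel σ)
  continuous_comp : ∀ {k l : ℕ} {a : Fin k → ℕ} (e : (Σ i, Fin (a i)) ≃ Fin l),
    Continuous fun x : O.Op k × (∀ i, O.Op (a i)) => O.comp e x.1 x.2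

/-- The exchange of the two indices of a rectangular array. -/
def swapIndex (k l : ℕ) : (Σ _ : Fin l, Fin k) ≃ (Σ _ : Fin k, Fin l) :=
  (Equiv.sigmaEquivProd _ _).trans
    ((Equiv.prodComm _ _).trans (Equiv.sigmaEquivProd _ _).symm)

end SymOperad

/-- A topological operad. -/
structure TopOperad extends SymOperad.{u} where
  top : ∀ j, TopologicalSpace (Op j)
  isTopologized : toSymOperad.IsTopologized top

attribute [instance] TopOperad.top

namespace TopOperad

/-- Morphisms of topological operads. -/
structure Hom (P R : TopOperad.{u}) where
  app : ∀ j, P.Op j → R.Op j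
  continuous_app : ∀ j, Continuous (app j)
  app_one : app 1 P.one = R.one
  app_relabel : ∀ {k l : ℕ} (σ : Fin k ≃ Fin l) (p : P.Op k),
    app l (P.relabel σ p) = R.relabel σ (app k p)
  app_comp : ∀ {k l : ℕ} {a : Fin k → ℕ} (e : (Σ i, Fin (a i)) ≃ Fin l) (p : P.Op k)
    (q : ∀ i, P.Op (a i)), app l (P.comp e p q) = R.comp e (app k p) (fun i => app (a i) (q i))

/-- The image of a morphism of topological operads, as a suboperad of the target with the
subspace topologies. -/
def Hom.range {P R : TopOperad.{u}} (f : Hom P R) : TopOperad.{u} where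
  Op j := Set.range (f.app j)
  one := ⟨R.one, P.one, f.app_one⟩
  relabel σ p := ⟨R.relabel σ p.1, by
    obtain ⟨_, p, rfl⟩ := p
    exact ⟨P.relabel σ p, f.app_relabel σ p⟩⟩
  comp e p q := ⟨R.comp e p.1 (fun i => (q i).1), by
    obtain ⟨_, p, rfl⟩ := p
    choose q' hq' using fun i => (q i).2
    refine ⟨P.comp e p q', ?_⟩
    rw [f.app_comp]
    simp only [hq']⟩
  relabel_refl p := Subtype.ext (R.relabel_refl _)
  relabel_relabel σ τ p := Subtype.ext (R.relabel_relabel _ _ _)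
  relabel_comp e σ p q := Subtype.ext (R.relabel_comp _ _ _ _)
  comp_relabel_left σ e p q := Subtype.ext (R.comp_relabel_left _ _ _ (fun i => (q i).1))
  comp_relabel_right σ e p q := Subtype.ext (R.comp_relabel_right _ _ _ (fun i => (q i).1))
  one_comp e q := Subtype.ext (R.one_comp _ _)
  comp_one e p := Subtype.ext (R.comp_one _ _)
  assoc e f g p q s := Subtype.ext
    (R.assoc e f g p.1 (fun i => (q i).1) (fun x => (s x).1))
  top _ := inferInstance
  isTopologized :=
    { continuous_relabel := fun σ =>
        ((R.isTopologized.continuous_relabel σ).comp continuous_subtype_val).subtype_mk _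
      continuous_comp := fun {k l a} e => by
        refine Continuous.subtype_mk ?_ _
        exact (R.isTopologized.continuous_comp e).comp
          (f := fun x : Set.range (f.app k) × (∀ i, Set.range (f.app (a i))) =>
            (x.1.1, fun i => (x.2 i).1)) (by fun_prop) }

/-- A morphism of topological operads, as a morphism onto its image. -/
def Hom.rangeRestrict {P R : TopOperad.{u}} (f : Hom P R) : Hom P f.range where
  app j p := ⟨f.app j p, p, rfl⟩
  continuous_app j := (f.continuous_app j).subtype_mk _
  app_one := Subtype.ext f.app_one
  app_relabel σ p := Subtype.ext (f.app_relabel σ p)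
  app_comp e p q := Subtype.ext (f.app_comp e p q)

/-! ### The Boardman–Vogt tensor product -/

/-- Formal operadic expressions in the operations of `P` and `Q`; the generators `inl p` and
`inr q` are the elementary operations `p ⊗ 1` and `1 ⊗ q`. -/
inductive Term (P Q : TopOperad.{u}) : ℕ → Type u
  | inl {k : ℕ} (p : P.Op k) : Term P Q k
  | inr {k : ℕ} (q : Q.Op k) : Term P Q k
  | one : Term P Q 1
  | relabel {k l : ℕ} (σ : Fin k ≃ Fin l) (t : Term P Q k) : Term P Q l
  | comp {k l : ℕ} {a : Fin k → ℕ} (e : (Σ i, Fin (a i)) ≃ Fin l)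
      (t : Term P Q k) (s : ∀ i, Term P Q (a i)) : Term P Q l

/-- The relations of the tensor product: the least congruence such that the operad axioms hold,
`p ↦ p ⊗ 1` and `q ↦ 1 ⊗ q` are morphisms of operads, and the interchange relation holds. -/
inductive TensorRel (P Q : TopOperad.{u}) : ∀ {j : ℕ}, Term P Q j → Term P Q j → Prop
  -- congruence
  | refl {j : ℕ} (t : Term P Q j) : TensorRel P Q t t
  | symm {j : ℕ} {t t' : Term P Q j} : TensorRel P Q t t' → TensorRel P Q t' t
  | trans {j : ℕ} {t t' t'' : Term P Q j} :
      TensorRel P Q t t' → TensorRel P Q t' t'' → TensorRel P Q t t''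
  | relabel_congr {k l : ℕ} (σ : Fin k ≃ Fin l) {t t' : Term P Q k} :
      TensorRel P Q t t' → TensorRel P Q (.relabel σ t) (.relabel σ t')
  | comp_congr {k l : ℕ} {a : Fin k → ℕ} (e : (Σ i, Fin (a i)) ≃ Fin l) {t t' : Term P Q k}
      {s s' : ∀ i, Term P Q (a i)} : TensorRel P Q t t' → (∀ i, TensorRel P Q (s i) (s' i)) →
      TensorRel P Q (.comp e t s) (.comp e t' s')
  -- operad axioms
  | relabel_refl {k : ℕ} (p : Term P Q k) : TensorRel P Q (.relabel (Equiv.refl _) p) p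
  | relabel_relabel {k l r : ℕ} (σ : Fin k ≃ Fin l) (τ : Fin l ≃ Fin r) (p : Term P Q k) :
      TensorRel P Q (.relabel τ (.relabel σ p)) (.relabel (σ.trans τ) p)
  | relabel_comp {k l r : ℕ} {a : Fin k → ℕ} (e : (Σ i, Fin (a i)) ≃ Fin l) (σ : Fin l ≃ Fin r)
      (p : Term P Q k) (q : ∀ i, Term P Q (a i)) :
      TensorRel P Q (.relabel σ (.comp e p q)) (.comp (e.trans σ) p q)
  | comp_relabel_left {k l r : ℕ} {a : Fin l → ℕ} (σ : Fin k ≃ Fin l)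
      (e : (Σ i, Fin (a i)) ≃ Fin r) (p : Term P Q k) (q : ∀ i, Term P Q (a i)) :
      TensorRel P Q (.comp e (.relabel σ p) q)
        (.comp ((Equiv.sigmaCongrLeft σ).trans e) p (fun i => q (σ i)))
  | comp_relabel_right {k l : ℕ} {a b : Fin k → ℕ} (σ : ∀ i, Fin (a i) ≃ Fin (b i))
      (e : (Σ i, Fin (b i)) ≃ Fin l) (p : Term P Q k) (q : ∀ i, Term P Q (a i)) :
      TensorRel P Q (.comp e p (fun i => .relabel (σ i) (q i)))
        (.comp ((Equiv.sigmaCongrRight σ).trans e) p q)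
  | one_comp {k l : ℕ} (e : (Σ _ : Fin 1, Fin k) ≃ Fin l) (q : Term P Q k) :
      TensorRel P Q (.comp e .one (fun _ => q))
        (.relabel ((Equiv.uniqueSigma fun _ : Fin 1 => Fin k).symm.trans e) q)
  | comp_one {k l : ℕ} (e : (Σ _ : Fin k, Fin 1) ≃ Fin l) (p : Term P Q k) :
      TensorRel P Q (.comp e p (fun _ => .one))
        (.relabel ((Equiv.sigmaUnique (Fin k) fun _ => Fin 1).symm.trans e) p)
  | assoc {k l r : ℕ} {a : Fin k → ℕ} {b : Fin l → ℕ} {c : Fin k → ℕ}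
      (e : (Σ i, Fin (a i)) ≃ Fin l) (f : ∀ i, (Σ x : Fin (a i), Fin (b (e ⟨i, x⟩))) ≃ Fin (c i))
      (g : (Σ i, Fin (c i)) ≃ Fin r) (p : Term P Q k) (q : ∀ i, Term P Q (a i))
      (s : ∀ x, Term P Q (b x)) :
      TensorRel P Q (.comp g p (fun i => .comp (f i) (q i) (fun x => s (e ⟨i, x⟩))))
        (.comp ((Equiv.sigmaCongrLeft e).symm.trans ((Equiv.sigmaAssoc _).trans
          ((Equiv.sigmaCongrRight f).trans g))) (.comp e p q) s)
  -- the two inclusions are morphisms of operads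
  | inl_one : TensorRel P Q (.inl P.one) .one
  | inl_relabel {k l : ℕ} (σ : Fin k ≃ Fin l) (p : P.Op k) :
      TensorRel P Q (.inl (P.relabel σ p)) (.relabel σ (.inl p))
  | inl_comp {k l : ℕ} {a : Fin k → ℕ} (e : (Σ i, Fin (a i)) ≃ Fin l) (p : P.Op k)
      (q : ∀ i, P.Op (a i)) :
      TensorRel P Q (.inl (P.comp e p q)) (.comp e (.inl p) (fun i => .inl (q i)))
  | inr_one : TensorRel P Q (.inr Q.one) .one
  | inr_relabel {k l : ℕ} (σ : Fin k ≃ Fin l) (p : Q.Op k) :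
      TensorRel P Q (.inr (Q.relabel σ p)) (.relabel σ (.inr p))
  | inr_comp {k l : ℕ} {a : Fin k → ℕ} (e : (Σ i, Fin (a i)) ≃ Fin l) (p : Q.Op k)
      (q : ∀ i, Q.Op (a i)) :
      TensorRel P Q (.inr (Q.comp e p q)) (.comp e (.inr p) (fun i => .inr (q i)))
  -- interchange (all arities, including zero)
  | interchange {k l r : ℕ} (e : (Σ _ : Fin k, Fin l) ≃ Fin r) (p : P.Op k) (q : Q.Op l) :
      TensorRel P Q (.comp e (.inl p) (fun _ => .inr q))
        (.comp ((SymOperad.swapIndex k l).trans e) (.inr q) (fun _ => .inl p))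

/-- The congruence `TensorRel` as a setoid. -/
def tensorSetoid (P Q : TopOperad.{u}) (j : ℕ) : Setoid (Term P Q j) where
  r := TensorRel P Q
  iseqv := ⟨.refl, .symm, .trans⟩

/-- Operations of arity `j` of the tensor product. -/
def TensorOp (P Q : TopOperad.{u}) (j : ℕ) : Type u := Quotient (tensorSetoid P Q j)

/-- The class of a formal expression in the tensor product. -/
def TensorOp.mk {P Q : TopOperad.{u}} {j : ℕ} (t : Term P Q j) : TensorOp P Q j :=
  Quotient.mk (tensorSetoid P Q j) t

theorem TensorOp.mk_surjective {P Q : TopOperad.{u}} {j : ℕ} :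
    Function.Surjective (TensorOp.mk : Term P Q j → TensorOp P Q j) :=
  Quotient.mk_surjective

theorem TensorOp.sound {P Q : TopOperad.{u}} {j : ℕ} {t t' : Term P Q j}
    (h : TensorRel P Q t t') : TensorOp.mk t = TensorOp.mk t' :=
  Quotient.sound (s := tensorSetoid P Q j) h

theorem TensorOp.exact {P Q : TopOperad.{u}} {j : ℕ} {t t' : Term P Q j}
    (h : TensorOp.mk t = TensorOp.mk t') : TensorRel P Q t t' :=
  Quotient.exact (s := tensorSetoid P Q j) h

/-- Relabelling in the tensor product. -/
def TensorOp.relabel {P Q : TopOperad.{u}} {k l : ℕ} (σ : Fin k ≃ Fin l) :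
    TensorOp P Q k → TensorOp P Q l :=
  Quotient.lift (fun t => TensorOp.mk (.relabel σ t)) fun _ _ h =>
    TensorOp.sound (.relabel_congr σ h)

/-- Composition in the tensor product, computed on representatives. -/
noncomputable def TensorOp.comp {P Q : TopOperad.{u}} {k l : ℕ} {a : Fin k → ℕ}
    (e : (Σ i, Fin (a i)) ≃ Fin l) (p : TensorOp P Q k) (q : ∀ i, TensorOp P Q (a i)) :
    TensorOp P Q l :=
  TensorOp.mk (.comp e (Quotient.out p) (fun i => Quotient.out (q i)))

theorem TensorOp.comp_mk {P Q : TopOperad.{u}} {k l : ℕ} {a : Fin k → ℕ}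
    (e : (Σ i, Fin (a i)) ≃ Fin l) (t : Term P Q k) (s : ∀ i, Term P Q (a i)) :
    TensorOp.comp e (TensorOp.mk t) (fun i => TensorOp.mk (s i)) = TensorOp.mk (.comp e t s) :=
  TensorOp.sound (.comp_congr e (Quotient.mk_out (s := tensorSetoid P Q k) t)
    fun i => Quotient.mk_out (s := tensorSetoid P Q (a i)) (s i))

theorem TensorOp.exists_rep {P Q : TopOperad.{u}} {k : ℕ} {a : Fin k → ℕ}
    (q : ∀ i, TensorOp P Q (a i)) : ∃ s : ∀ i, Term P Q (a i), q = fun i => TensorOp.mk (s i) := by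
  choose s hs using fun i => TensorOp.mk_surjective (q i)
  exact ⟨s, funext fun i => (hs i).symm⟩

/-- The underlying operad in sets of the Boardman–Vogt tensor product. -/
noncomputable def tensorSym (P Q : TopOperad.{u}) : SymOperad.{u} where
  Op := TensorOp P Q
  one := TensorOp.mk .one
  relabel := TensorOp.relabel
  comp := TensorOp.comp
  relabel_refl p := by
    obtain ⟨p, rfl⟩ := TensorOp.mk_surjective p
    exact TensorOp.sound (.relabel_refl p)
  relabel_relabel σ τ p := by
    obtain ⟨p, rfl⟩ := TensorOp.mk_surjective p
    exact TensorOp.sound (.relabel_relabel σ τ p)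
  relabel_comp e σ p q := by
    obtain ⟨p, rfl⟩ := TensorOp.mk_surjective p
    obtain ⟨q, rfl⟩ := TensorOp.exists_rep q
    rw [TensorOp.comp_mk, TensorOp.comp_mk]
    exact TensorOp.sound (.relabel_comp e σ p q)
  comp_relabel_left σ e p q := by
    obtain ⟨p, rfl⟩ := TensorOp.mk_surjective p
    obtain ⟨q, rfl⟩ := TensorOp.exists_rep q
    rw [TensorOp.comp_mk (s := fun i => q (σ i))]
    exact (TensorOp.comp_mk _ (.relabel σ p) _).trans
      (TensorOp.sound (.comp_relabel_left σ e p q))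
  comp_relabel_right σ e p q := by
    obtain ⟨p, rfl⟩ := TensorOp.mk_surjective p
    obtain ⟨q, rfl⟩ := TensorOp.exists_rep q
    rw [TensorOp.comp_mk]
    exact (TensorOp.comp_mk _ _ (fun i => .relabel (σ i) (q i))).trans
      (TensorOp.sound (.comp_relabel_right σ e p q))
  one_comp e q := by
    obtain ⟨q, rfl⟩ := TensorOp.mk_surjective q
    exact (TensorOp.comp_mk _ _ (fun _ => q)).trans (TensorOp.sound (.one_comp e q))
  comp_one e p := by
    obtain ⟨p, rfl⟩ := TensorOp.mk_surjective p
    exact (TensorOp.comp_mk _ _ (fun _ => .one)).trans (TensorOp.sound (.comp_one e p))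
  assoc e f g p q s := by
    obtain ⟨p, rfl⟩ := TensorOp.mk_surjective p
    obtain ⟨q, rfl⟩ := TensorOp.exists_rep q
    obtain ⟨s, rfl⟩ := TensorOp.exists_rep s
    have h : ∀ i, TensorOp.comp (f i) (TensorOp.mk (q i)) (fun x => TensorOp.mk (s (e ⟨i, x⟩))) =
        TensorOp.mk (.comp (f i) (q i) (fun x => s (e ⟨i, x⟩))) :=
      fun i => TensorOp.comp_mk _ _ (fun x => s (e ⟨i, x⟩))
    refine Eq.trans ?_ (Eq.trans (TensorOp.sound (.assoc e f g p q s)) ?_)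
    · rw [← TensorOp.comp_mk]
      exact congrArg _ (funext h)
    · rw [← TensorOp.comp_mk, ← TensorOp.comp_mk]

/-- Topologies on the tensor product that make it a topological operad and for which both
inclusions `p ↦ p ⊗ 1` and `q ↦ 1 ⊗ q` are continuous. -/
structure IsTensorTopology (P Q : TopOperad.{u}) (τ : ∀ j, TopologicalSpace (TensorOp P Q j)) :
    Prop where
  isTopologized : (tensorSym P Q).IsTopologized τ
  continuous_inl : ∀ j, Continuous fun p : P.Op j => (TensorOp.mk (.inl p) : TensorOp P Q j)
  continuous_inr : ∀ j, Continuous fun q : Q.Op j => (TensorOp.mk (.inr q) : TensorOp P Q j)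

/-- The topology of the tensor product: the finest one for which it is a topological operad and
the two inclusions are continuous (in Mathlib's order, finer topologies are smaller). -/
@[reducible] def tensorTopology (P Q : TopOperad.{u}) (j : ℕ) : TopologicalSpace (TensorOp P Q j) :=
  ⨅ τ : {τ : ∀ j, TopologicalSpace (TensorOp P Q j) // IsTensorTopology P Q τ}, τ.1 j

theorem tensorTopology_le {P Q : TopOperad.{u}} {τ : ∀ j, TopologicalSpace (TensorOp P Q j)}
    (h : IsTensorTopology P Q τ) (j : ℕ) : tensorTopology P Q j ≤ τ j :=
  iInf_le (fun τ : {τ : ∀ j, TopologicalSpace (TensorOp P Q j) // IsTensorTopology P Q τ} =>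
    τ.1 j) ⟨τ, h⟩

theorem isTensorTopology_tensorTopology (P Q : TopOperad.{u}) :
    IsTensorTopology P Q (tensorTopology P Q) where
  isTopologized :=
    { continuous_relabel := fun {k l} σ => by
        refine continuous_iInf_rng.2 fun τ => ?_
        exact continuous_le_dom (tensorTopology_le τ.2 k)
          (τ.2.isTopologized.continuous_relabel σ)
      continuous_comp := fun {k l a} e => by
        refine continuous_iInf_rng.2 fun τ => ?_
        refine continuous_le_dom ?_ (τ.2.isTopologized.continuous_comp e)
        exact inf_le_inf (induced_mono (tensorTopology_le τ.2 k))
          (induced_mono (iInf_mono fun i => induced_mono (tensorTopology_le τ.2 (a i)))) }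
  continuous_inl j := continuous_iInf_rng.2 fun τ => τ.2.continuous_inl j
  continuous_inr j := continuous_iInf_rng.2 fun τ => τ.2.continuous_inr j

/-- The Boardman–Vogt tensor product `P ⊗ Q` of topological operads. -/
noncomputable def tensor (P Q : TopOperad.{u}) : TopOperad.{u} where
  toSymOperad := tensorSym P Q
  top := tensorTopology P Q
  isTopologized := (isTensorTopology_tensorTopology P Q).isTopologized

/-- Two morphisms into the same operad interchange. -/
def Interchange {P Q R : TopOperad.{u}} (f : Hom P R) (g : Hom Q R) : Prop :=
  ∀ {k l r : ℕ} (e : (Σ _ : Fin k, Fin l) ≃ Fin r) (p : P.Op k) (q : Q.Op l),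
    R.comp e (f.app k p) (fun _ => g.app l q) =
      R.comp ((SymOperad.swapIndex k l).trans e) (g.app l q) (fun _ => f.app k p)

/-- Evaluation of a formal expression in an operad to which `P` and `Q` are mapped. -/
def Term.eval {P Q R : TopOperad.{u}} (f : Hom P R) (g : Hom Q R) : ∀ {j : ℕ},
    Term P Q j → R.Op j
  | _, .inl p => f.app _ p
  | _, .inr q => g.app _ q
  | _, .one => R.one
  | _, .relabel σ t => R.relabel σ (t.eval f g)
  | _, .comp e t s => R.comp e (t.eval f g) (fun i => (s i).eval f g)

theorem Term.eval_eq {P Q R : TopOperad.{u}} (f : Hom P R) (g : Hom Q R)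
    (h : Interchange f g) {j : ℕ} {t t' : Term P Q j} (ht : TensorRel P Q t t') :
    t.eval f g = t'.eval f g := by
  induction ht with
  | refl => rfl
  | symm _ ih => exact ih.symm
  | trans _ _ ih ih' => exact ih.trans ih'
  | relabel_congr σ _ ih => simp only [Term.eval, ih]
  | comp_congr e _ _ ih ih' => simp only [Term.eval, ih, ih']
  | relabel_refl => exact R.relabel_refl _
  | relabel_relabel => exact R.relabel_relabel _ _ _
  | relabel_comp => exact R.relabel_comp _ _ _ _
  | comp_relabel_left σ e p q =>
    exact R.comp_relabel_left σ e (p.eval f g) (fun i => (q i).eval f g)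
  | comp_relabel_right σ e p q =>
    exact R.comp_relabel_right σ e (p.eval f g) (fun i => (q i).eval f g)
  | one_comp => exact R.one_comp _ _
  | comp_one => exact R.comp_one _ _
  | assoc e f' g' p q s =>
    exact R.assoc e f' g' (p.eval f g) (fun i => (q i).eval f g) (fun x => (s x).eval f g)
  | inl_one => exact f.app_one
  | inl_relabel => exact f.app_relabel _ _
  | inl_comp => exact f.app_comp _ _ _
  | inr_one => exact g.app_one
  | inr_relabel => exact g.app_relabel _ _
  | inr_comp => exact g.app_comp _ _ _
  | interchange e p q => exact h e p q

/-- The map on operations induced on the tensor product by two interchanging morphisms. -/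
def TensorOp.eval {P Q R : TopOperad.{u}} (f : Hom P R) (g : Hom Q R) (h : Interchange f g)
    (j : ℕ) : TensorOp P Q j → R.Op j :=
  Quotient.lift (Term.eval f g) fun _ _ ht => Term.eval_eq f g h ht

theorem TensorOp.eval_relabel {P Q R : TopOperad.{u}} (f : Hom P R) (g : Hom Q R)
    (h : Interchange f g) {k l : ℕ} (σ : Fin k ≃ Fin l) (p : TensorOp P Q k) :
    TensorOp.eval f g h l (TensorOp.relabel σ p) = R.relabel σ (TensorOp.eval f g h k p) := by
  obtain ⟨p, rfl⟩ := TensorOp.mk_surjective p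
  rfl

theorem TensorOp.eval_comp {P Q R : TopOperad.{u}} (f : Hom P R) (g : Hom Q R)
    (h : Interchange f g) {k l : ℕ} {a : Fin k → ℕ} (e : (Σ i, Fin (a i)) ≃ Fin l)
    (p : TensorOp P Q k) (q : ∀ i, TensorOp P Q (a i)) :
    TensorOp.eval f g h l (TensorOp.comp e p q) =
      R.comp e (TensorOp.eval f g h k p) (fun i => TensorOp.eval f g h (a i) (q i)) := by
  obtain ⟨p, rfl⟩ := TensorOp.mk_surjective p
  obtain ⟨q, rfl⟩ := TensorOp.exists_rep q
  rw [TensorOp.comp_mk]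
  rfl

theorem isTensorTopology_induced {P Q R : TopOperad.{u}} (f : Hom P R) (g : Hom Q R)
    (h : Interchange f g) :
    IsTensorTopology P Q (fun j => (R.top j).induced (TensorOp.eval f g h j)) := by
  let τ : ∀ j, TopologicalSpace (TensorOp P Q j) :=
    fun j => (R.top j).induced (TensorOp.eval f g h j)
  have hc : ∀ j, Continuous (TensorOp.eval f g h j) := fun j => continuous_induced_dom
  refine ⟨⟨fun {k l} σ => ?_, fun {k l a} e => ?_⟩, fun j => ?_, fun j => ?_⟩
  · refine continuous_induced_rng.2 ?_
    exact ((R.isTopologized.continuous_relabel σ).comp (hc k)).congr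
      fun p => (TensorOp.eval_relabel f g h σ p).symm
  · refine continuous_induced_rng.2 ?_
    have h1 : Continuous fun x : TensorOp P Q k × (∀ i, TensorOp P Q (a i)) =>
        (TensorOp.eval f g h k x.1, fun i => TensorOp.eval f g h (a i) (x.2 i)) :=
      ((hc k).comp continuous_fst).prodMk
        (continuous_pi fun i => (hc (a i)).comp ((continuous_apply i).comp continuous_snd))
    exact ((R.isTopologized.continuous_comp e).comp h1).congr
      fun x => (TensorOp.eval_comp f g h e x.1 x.2).symm
  · exact continuous_induced_rng.2 (f.continuous_app j)
  · exact continuous_induced_rng.2 (g.continuous_app j)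

/-- The morphism `P ⊗ Q → R` induced by two interchanging morphisms `P → R` and `Q → R`, with
`p ⊗ 1 ↦ f p` and `1 ⊗ q ↦ g q`. -/
noncomputable def tensorLift {P Q R : TopOperad.{u}} (f : Hom P R) (g : Hom Q R)
    (h : Interchange f g) : Hom (tensor P Q) R where
  app := TensorOp.eval f g h
  continuous_app j := continuous_iff_le_induced.2
    (tensorTopology_le (isTensorTopology_induced f g h) j)
  app_one := rfl
  app_relabel := TensorOp.eval_relabel f g h
  app_comp := TensorOp.eval_comp f g h

end TopOperad

/-! ### Little cubes -/

/-- A little `n`-cube, given by its lower corner `c.1.1` and its upper corner `c.1.2`. It stands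
for the rectilinear embedding `x ↦ lo + (hi - lo) * x` of the open unit cube in itself. -/
def LittleCube (n : ℕ) : Type :=
  {c : (Fin n → ℝ) × (Fin n → ℝ) // ∀ i, 0 ≤ c.1 i ∧ c.1 i < c.2 i ∧ c.2 i ≤ 1}

namespace LittleCube

instance (n : ℕ) : TopologicalSpace (LittleCube n) := instTopologicalSpaceSubtype

variable {n m : ℕ}

/-- The lower corner. -/
def lo (c : LittleCube n) : Fin n → ℝ := c.1.1

/-- The upper corner. -/
def hi (c : LittleCube n) : Fin n → ℝ := c.1.2

@[ext] theorem ext {c d : LittleCube n} (h : ∀ i, c.lo i = d.lo i) (h' : ∀ i, c.hi i = d.hi i) :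
    c = d :=
  Subtype.ext (Prod.ext (funext h) (funext h'))

theorem continuous_lo : Continuous (lo : LittleCube n → _) :=
  continuous_fst.comp continuous_subtype_val

theorem continuous_hi : Continuous (hi : LittleCube n → _) :=
  continuous_snd.comp continuous_subtype_val

/-- The embedding of the cube in itself. -/
def embed (c : LittleCube n) (x : Fin n → ℝ) : Fin n → ℝ :=
  fun i => c.lo i + (c.hi i - c.lo i) * x i

/-- The image of the open unit cube under the embedding. -/
def image (c : LittleCube n) : Set (Fin n → ℝ) :=
  c.embed '' Set.univ.pi fun _ => Set.Ioo 0 1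

/-- The identity of the unit cube. -/
def id (n : ℕ) : LittleCube n := ⟨(fun _ => 0, fun _ => 1), by simp⟩

/-- The composite embedding `c ∘ d`. -/
def comp (c d : LittleCube n) : LittleCube n :=
  ⟨(c.embed d.lo, c.embed d.hi), fun i => by
    obtain ⟨h1, h2, h3⟩ := c.2 i
    obtain ⟨h4, h5, h6⟩ := d.2 i
    simp only [embed, lo, hi]
    exact ⟨by nlinarith, by nlinarith, by nlinarith⟩⟩

theorem lo_comp (c d : LittleCube n) : (c.comp d).lo = c.embed d.lo := rfl

theorem hi_comp (c d : LittleCube n) : (c.comp d).hi = c.embed d.hi := rfl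

theorem embed_comp (c d : LittleCube n) : (c.comp d).embed = c.embed ∘ d.embed := by
  funext x i
  simp only [embed, lo_comp, hi_comp, Function.comp]
  ring

theorem embed_injective (c : LittleCube n) : Function.Injective c.embed := by
  intro x y h
  funext i
  have hi := congrFun h i
  have h2 : c.hi i - c.lo i ≠ 0 := (sub_pos.2 (c.2 i).2.1).ne'
  simpa [embed, h2] using hi

theorem image_subset (c : LittleCube n) : c.image ⊆ Set.univ.pi fun _ => Set.Ioo 0 1 := by
  rintro _ ⟨x, hx, rfl⟩ i -
  obtain ⟨h1, h2, h3⟩ := c.2 i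
  obtain ⟨h4, h5⟩ := hx i trivial
  simp only [embed, lo, hi, Set.mem_Ioo]
  exact ⟨by nlinarith, by nlinarith⟩

theorem image_comp (c d : LittleCube n) : (c.comp d).image = c.embed '' d.image := by
  rw [image, embed_comp, Set.image_comp]
  rfl

theorem image_comp_subset (c d : LittleCube n) : (c.comp d).image ⊆ c.image := by
  rw [image_comp]
  exact Set.image_mono d.image_subset

theorem id_comp (c : LittleCube n) : (id n).comp c = c := by
  ext i <;> simp [comp, id, embed, lo, hi]

theorem comp_id (c : LittleCube n) : c.comp (id n) = c := by
  ext i <;> simp [comp, id, embed, lo, hi]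

theorem comp_assoc (c d e : LittleCube n) : (c.comp d).comp e = c.comp (d.comp e) := by
  ext i
  · rw [lo_comp, lo_comp, lo_comp, embed_comp]; rfl
  · rw [hi_comp, hi_comp, hi_comp, embed_comp]; rfl

theorem continuous_comp :
    Continuous fun x : LittleCube n × LittleCube n => x.1.comp x.2 := by
  have h1 := continuous_lo (n := n)
  have h2 := continuous_hi (n := n)
  refine Continuous.subtype_mk (Continuous.prodMk ?_ ?_) _ <;>
  · refine continuous_pi fun i => ?_
    change Continuous fun x : LittleCube n × LittleCube n =>
      x.1.lo i + (x.1.hi i - x.1.lo i) * _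
    fun_prop

/-- The product of a little `n`-cube with a little `m`-cube. -/
def prod (c : LittleCube n) (d : LittleCube m) : LittleCube (n + m) :=
  ⟨(Fin.append c.lo d.lo, Fin.append c.hi d.hi), fun i => by
    refine Fin.addCases (fun i => ?_) (fun i => ?_) i
    · simp only [Fin.append_left]
      exact c.2 i
    · simp only [Fin.append_right]
      exact d.2 i⟩

theorem prod_comp_prod (c c' : LittleCube n) (d d' : LittleCube m) :
    (c.prod d).comp (c'.prod d') = (c.comp c').prod (d.comp d') := by
  ext i <;> refine Fin.addCases (fun i => ?_) (fun i => ?_) i <;>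
    simp [comp, prod, lo, hi, embed]

theorem id_prod_id : (id n).prod (id m) = id (n + m) := by
  ext i <;> refine Fin.addCases (fun i => ?_) (fun i => ?_) i <;> simp [id, prod, lo, hi]

theorem continuous_prod : Continuous fun x : LittleCube n × LittleCube m => x.1.prod x.2 := by
  have h1 := continuous_lo (n := n)
  have h2 := continuous_hi (n := n)
  have h3 := continuous_lo (n := m)
  have h4 := continuous_hi (n := m)
  refine Continuous.subtype_mk (Continuous.prodMk ?_ ?_) _ <;>
  · refine continuous_pi fun i => ?_
    refine Fin.addCases (fun i => ?_) (fun i => ?_) i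
    · simp only [Fin.append_left]
      fun_prop
    · simp only [Fin.append_right]
      fun_prop

theorem exists_of_mem_image_prod {c : LittleCube n} {d : LittleCube m} {x : Fin (n + m) → ℝ}
    (hx : x ∈ (c.prod d).image) : (fun i => x (Fin.castAdd m i)) ∈ c.image ∧
      (fun i => x (Fin.natAdd n i)) ∈ d.image := by
  obtain ⟨y, hy, rfl⟩ := hx
  refine ⟨⟨fun i => y (Fin.castAdd m i), fun i _ => hy _ trivial, ?_⟩,
    ⟨fun i => y (Fin.natAdd n i), fun i _ => hy _ trivial, ?_⟩⟩ <;>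
  · funext i
    simp [embed, prod, lo, hi]

end LittleCube

/-- Operations of arity `j` of the little `n`-cubes operad: `j`-tuples of little `n`-cubes with
pairwise disjoint images, with the topology given by the coordinates of the corners. -/
def CubeConfig (n j : ℕ) : Type :=
  {c : Fin j → LittleCube n // Pairwise fun x y => Disjoint (c x).image (c y).image}

instance (n j : ℕ) : TopologicalSpace (CubeConfig n j) := instTopologicalSpaceSubtype

namespace CubeConfig

open LittleCube

variable {n : ℕ}

/-- The unit configuration. -/
def one (n : ℕ) : CubeConfig n 1 :=
  ⟨fun _ => LittleCube.id n, fun x y h => (h (Subsingleton.elim x y)).elim⟩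

/-- Relabelling of the cubes of a configuration. -/
def relabel {k l : ℕ} (σ : Fin k ≃ Fin l) (c : CubeConfig n k) : CubeConfig n l :=
  ⟨fun x => c.1 (σ.symm x), fun _ _ h => c.2 fun h' => h (σ.symm.injective h')⟩

/-- Composition of configurations: the configuration `d i` is inserted into the cube `c i`. -/
def comp {k l : ℕ} {a : Fin k → ℕ} (e : (Σ i, Fin (a i)) ≃ Fin l) (c : CubeConfig n k)
    (d : ∀ i, CubeConfig n (a i)) : CubeConfig n l :=
  ⟨fun x => (c.1 (e.symm x).1).comp ((d (e.symm x).1).1 (e.symm x).2), by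
    have key : ∀ u v : (Σ i, Fin (a i)), u ≠ v →
        Disjoint ((c.1 u.1).comp ((d u.1).1 u.2)).image
          ((c.1 v.1).comp ((d v.1).1 v.2)).image := by
      rintro ⟨i, x⟩ ⟨i', y⟩ huv
      by_cases h : i = i'
      · subst h
        have hxy : x ≠ y := fun h => huv (by rw [h])
        rw [image_comp, image_comp]
        exact (Set.disjoint_image_iff (embed_injective _)).2 ((d i).2 hxy)
      · exact (c.2 h).mono (image_comp_subset _ _) (image_comp_subset _ _)
    exact fun x y hxy => key _ _ fun h => hxy (e.symm.injective h)⟩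

theorem comp_relabel_left {k l r : ℕ} {a : Fin l → ℕ} (σ : Fin k ≃ Fin l)
    (e : (Σ i, Fin (a i)) ≃ Fin r) (p : CubeConfig n k) (q : ∀ i, CubeConfig n (a i)) :
    comp e (relabel σ p) q = comp ((Equiv.sigmaCongrLeft σ).trans e) p (fun i => q (σ i)) := by
  have key : ∀ u : (Σ i, Fin (a i)),
      (p.1 (σ.symm u.1)).comp ((q u.1).1 u.2) =
      (p.1 ((Equiv.sigmaCongrLeft σ).symm u).1).comp
        ((q (σ ((Equiv.sigmaCongrLeft σ).symm u).1)).1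
          ((Equiv.sigmaCongrLeft (β := fun i => Fin (a i)) σ).symm u).2) := by
    intro u
    obtain ⟨⟨i, x⟩, rfl⟩ := (Equiv.sigmaCongrLeft (β := fun i => Fin (a i)) σ).surjective u
    rw [Equiv.symm_apply_apply]
    change (p.1 (σ.symm (σ i))).comp _ = _
    rw [Equiv.symm_apply_apply]
    rfl
  exact Subtype.ext (funext fun x => key (e.symm x))

theorem one_comp {k l : ℕ} (e : (Σ _ : Fin 1, Fin k) ≃ Fin l) (q : CubeConfig n k) :
    comp e (one n) (fun _ => q) =
      relabel ((Equiv.uniqueSigma fun _ : Fin 1 => Fin k).symm.trans e) q := by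
  have key : ∀ u : (Σ _ : Fin 1, Fin k),
      (LittleCube.id n).comp (q.1 u.2) = q.1 (Equiv.uniqueSigma (fun _ : Fin 1 => Fin k) u) := by
    rintro ⟨i, x⟩
    obtain rfl : i = default := Subsingleton.elim _ _
    exact LittleCube.id_comp _
  exact Subtype.ext (funext fun x => key (e.symm x))

theorem comp_one {k l : ℕ} (e : (Σ _ : Fin k, Fin 1) ≃ Fin l) (p : CubeConfig n k) :
    comp e p (fun _ => one n) =
      relabel ((Equiv.sigmaUnique (Fin k) fun _ => Fin 1).symm.trans e) p :=
  Subtype.ext (funext fun _ => LittleCube.comp_id _)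

theorem assoc {k l r : ℕ} {a : Fin k → ℕ} {b : Fin l → ℕ} {c : Fin k → ℕ}
    (e : (Σ i, Fin (a i)) ≃ Fin l) (f : ∀ i, (Σ x : Fin (a i), Fin (b (e ⟨i, x⟩))) ≃ Fin (c i))
    (g : (Σ i, Fin (c i)) ≃ Fin r) (p : CubeConfig n k) (q : ∀ i, CubeConfig n (a i))
    (s : ∀ x, CubeConfig n (b x)) :
    comp g p (fun i => comp (f i) (q i) (fun x => s (e ⟨i, x⟩))) =
      comp ((Equiv.sigmaCongrLeft e).symm.trans ((Equiv.sigmaAssoc _).trans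
        ((Equiv.sigmaCongrRight f).trans g))) (comp e p q) s := by
  have key : ∀ (u : (Σ i, Σ x : Fin (a i), Fin (b (e ⟨i, x⟩)))) (w : Σ x, Fin (b x)),
      w = ⟨e ⟨u.1, u.2.1⟩, u.2.2⟩ →
      (p.1 u.1).comp (((q u.1).1 u.2.1).comp ((s (e ⟨u.1, u.2.1⟩)).1 u.2.2)) =
      ((p.1 (e.symm w.1).1).comp ((q (e.symm w.1).1).1 (e.symm w.1).2)).comp
        ((s w.1).1 w.2) := by
    rintro ⟨i, x, y⟩ _ rfl
    dsimp only
    rw [Equiv.symm_apply_apply, LittleCube.comp_assoc]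
  refine Subtype.ext (funext fun x => ?_)
  exact key ((Equiv.sigmaCongrRight f).symm (g.symm x)) _ rfl

theorem continuous_relabel {k l : ℕ} (σ : Fin k ≃ Fin l) :
    Continuous (relabel σ : CubeConfig n k → CubeConfig n l) :=
  continuous_induced_rng.2 (continuous_pi fun x =>
    (continuous_apply (σ.symm x)).comp continuous_subtype_val)

theorem continuous_comp {k l : ℕ} {a : Fin k → ℕ} (e : (Σ i, Fin (a i)) ≃ Fin l) :
    Continuous fun x : CubeConfig n k × (∀ i, CubeConfig n (a i)) => comp e x.1 x.2 := by
  refine Continuous.subtype_mk (continuous_pi fun x => ?_) _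
  refine LittleCube.continuous_comp.comp (Continuous.prodMk ?_ ?_)
  · exact (continuous_apply _).comp (continuous_subtype_val.comp continuous_fst)
  · exact (continuous_apply (e.symm x).2).comp (continuous_subtype_val.comp
      ((continuous_apply (e.symm x).1).comp continuous_snd))

end CubeConfig

/-- The little `n`-cubes operad `C_n`, with a single nullary operation. -/
def littleCubes (n : ℕ) : TopOperad.{0} where
  Op := CubeConfig n
  one := CubeConfig.one n
  relabel := CubeConfig.relabel
  comp := CubeConfig.comp
  relabel_refl _ := rfl
  relabel_relabel _ _ _ := rfl
  relabel_comp _ _ _ _ := rfl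
  comp_relabel_left := CubeConfig.comp_relabel_left
  comp_relabel_right _ _ _ _ := rfl
  one_comp := CubeConfig.one_comp
  comp_one := CubeConfig.comp_one
  assoc := CubeConfig.assoc
  top _ := inferInstance
  isTopologized :=
    { continuous_relabel := CubeConfig.continuous_relabel
      continuous_comp := CubeConfig.continuous_comp }

/-- The configuration obtained by multiplying every little `n`-cube with `]0,1[^m`. -/
def CubeConfig.prodRight (n m : ℕ) {j : ℕ} (c : CubeConfig n j) : CubeConfig (n + m) j :=
  ⟨fun x => (c.1 x).prod (LittleCube.id m), fun _ _ h => Set.disjoint_left.2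
    fun _ h1 h2 => Set.disjoint_left.1 (c.2 h) (LittleCube.exists_of_mem_image_prod h1).1
      (LittleCube.exists_of_mem_image_prod h2).1⟩

/-- The configuration obtained by multiplying `]0,1[^n` with every little `m`-cube. -/
def CubeConfig.prodLeft (n m : ℕ) {j : ℕ} (c : CubeConfig m j) : CubeConfig (n + m) j :=
  ⟨fun x => (LittleCube.id n).prod (c.1 x), fun _ _ h => Set.disjoint_left.2
    fun _ h1 h2 => Set.disjoint_left.1 (c.2 h) (LittleCube.exists_of_mem_image_prod h1).2
      (LittleCube.exists_of_mem_image_prod h2).2⟩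

theorem CubeConfig.prodRight_comp (n m : ℕ) {k l : ℕ} {a : Fin k → ℕ}
    (e : (Σ i, Fin (a i)) ≃ Fin l) (p : CubeConfig n k) (q : ∀ i, CubeConfig n (a i)) :
    (comp e p q).prodRight n m = comp e (p.prodRight n m) (fun i => (q i).prodRight n m) :=
  Subtype.ext (funext fun x => by
    have h := LittleCube.prod_comp_prod (p.1 (e.symm x).1)
      ((q (e.symm x).1).1 (e.symm x).2) (LittleCube.id m) (LittleCube.id m)
    rw [LittleCube.id_comp] at h
    exact h.symm)

theorem CubeConfig.prodLeft_comp (n m : ℕ) {k l : ℕ} {a : Fin k → ℕ}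
    (e : (Σ i, Fin (a i)) ≃ Fin l) (p : CubeConfig m k) (q : ∀ i, CubeConfig m (a i)) :
    (comp e p q).prodLeft n m = comp e (p.prodLeft n m) (fun i => (q i).prodLeft n m) :=
  Subtype.ext (funext fun x => by
    have h := LittleCube.prod_comp_prod (LittleCube.id n) (LittleCube.id n)
      (p.1 (e.symm x).1) ((q (e.symm x).1).1 (e.symm x).2)
    rw [LittleCube.id_comp] at h
    exact h.symm)

theorem CubeConfig.interchange (n m : ℕ) {k l r : ℕ} (e : (Σ _ : Fin k, Fin l) ≃ Fin r)
    (p : CubeConfig n k) (q : CubeConfig m l) :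
    comp e (p.prodRight n m) (fun _ => q.prodLeft n m) =
      comp ((SymOperad.swapIndex k l).trans e) (q.prodLeft n m) (fun _ => p.prodRight n m) := by
  refine Subtype.ext (funext fun x => ?_)
  refine (LittleCube.prod_comp_prod _ _ _ _).trans
    (Eq.trans ?_ (LittleCube.prod_comp_prod _ _ _ _).symm)
  rw [LittleCube.id_comp, LittleCube.id_comp, LittleCube.comp_id, LittleCube.comp_id]
  rfl

theorem CubeConfig.continuous_prodRight (n m j : ℕ) :
    Continuous (CubeConfig.prodRight n m : CubeConfig n j → CubeConfig (n + m) j) :=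
  continuous_induced_rng.2 (continuous_pi fun x =>
    LittleCube.continuous_prod.comp (Continuous.prodMk
      ((continuous_apply x).comp continuous_subtype_val) continuous_const))

theorem CubeConfig.continuous_prodLeft (n m j : ℕ) :
    Continuous (CubeConfig.prodLeft n m : CubeConfig m j → CubeConfig (n + m) j) :=
  continuous_induced_rng.2 (continuous_pi fun x =>
    LittleCube.continuous_prod.comp (Continuous.prodMk continuous_const
      ((continuous_apply x).comp continuous_subtype_val)))

/-- The morphism `μ₁ : C_n → C_{n+m}`, which multiplies every cube with `]0,1[^m`. -/
def cubesInl (n m : ℕ) : (littleCubes n).Hom (littleCubes (n + m)) where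
  app j c := CubeConfig.prodRight n m (j := j) c
  continuous_app := CubeConfig.continuous_prodRight n m
  app_one := Subtype.ext (funext fun _ => LittleCube.id_prod_id)
  app_relabel _ _ := rfl
  app_comp e p q := CubeConfig.prodRight_comp n m e p q

/-- The morphism `μ₂ : C_m → C_{n+m}`, which multiplies `]0,1[^n` with every cube. -/
def cubesInr (n m : ℕ) : (littleCubes m).Hom (littleCubes (n + m)) where
  app j c := CubeConfig.prodLeft n m (j := j) c
  continuous_app := CubeConfig.continuous_prodLeft n m
  app_one := Subtype.ext (funext fun _ => LittleCube.id_prod_id)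
  app_relabel _ _ := rfl
  app_comp e p q := CubeConfig.prodLeft_comp n m e p q

theorem interchange_cubes (n m : ℕ) : TopOperad.Interchange (cubesInl n m) (cubesInr n m) :=
  fun e p q => CubeConfig.interchange n m e p q

/-- The morphism `μ : C_n ⊗ C_m → C_{n+m}` induced by `μ₁` and `μ₂`. -/
noncomputable def cubesMu (n m : ℕ) :
    ((littleCubes n).tensor (littleCubes m)).Hom (littleCubes (n + m)) :=
  TopOperad.tensorLift (cubesInl n m) (cubesInr n m) (interchange_cubes n m)

/-- The operad `C_n|C_m`: the image of `μ`, a suboperad of `C_{n+m}`. -/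
noncomputable def cubesBar (n m : ℕ) : TopOperad.{0} := (cubesMu n m).range

/-- The morphism `μ' : C_n ⊗ C_m → C_n|C_m`, through which `μ` factors. -/
noncomputable def cubesMuRange (n m : ℕ) :
    ((littleCubes n).tensor (littleCubes m)).Hom (cubesBar n m) :=
  (cubesMu n m).rangeRestrict

/-! Continuity and surjectivity are built into the morphism onto the image, so the content is the
injectivity of `μ`: an operation of `C_n ⊗ C_m` is determined by its cubes. The shadows of an
operation are the projections of its cubes to the first `n` and to the last `m` coordinates.

The key is a factorization, `CubeDirection.Built.exists_comp_incl`. Suppose that the first shadow of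
every input `u` of `x` lies in the cube `f u` of a configuration `p` of `n`-cubes. Then `x = (p ⊗ 1)
∘ (y_i)`, where the inputs of `y_i` are those with `f u = i`. The proof is an induction on the way
`x` is generated. If `x = (p' ⊗ 1) ∘ (t_i)`, each `t_i` factors by induction through the restriction
of `p` to the cube `p'_i`. Now `p'` composed with the restrictions of `p` is the common refinement
of both, hence also `p` composed with the restrictions of `p'`, and regrouping gives the claim.
Pieces of the refinement without inputs receive nullary operations. If `x = (1 ⊗ q) ∘ (t_i)`, every
`t_i` factors through `p` itself, and interchange moves `p` past `q`.

Uniqueness follows by induction on `x` (`CubeDirection.Determined.comp_incl`). If `x = (p ⊗ 1) ∘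
(t_i)` and `x'` has the same cubes, then `x'` factors through `p` with the same distribution of
inputs, and cancelling the embeddings reduces the claim to the `t_i`. The generators `1 ⊗ q` are
treated symmetrically. The base case, that only the unit has the full cube as its single cube, is an
induction of its own (`CubeDirection.UnitDetermined.comp_incl`). -/

namespace SymOperad

/-! ### Regrouping of iterated composites -/

variable (O : SymOperad.{u})

/-- Composites of a family selected along equal index functions agree. -/
theorem comp_congr_index {k l : ℕ} {W : Type*} {b : W → ℕ} (S : ∀ w, O.Op (b w))
    {γ γ' : Fin k → W} (h : γ = γ') (G : (Σ i, Fin (b (γ i))) ≃ Fin l)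
    (G' : (Σ i, Fin (b (γ' i))) ≃ Fin l)
    (hG : ∀ i v v', HEq v v' → G ⟨i, v⟩ = G' ⟨i, v'⟩) (p : O.Op k) :
    O.comp G p (fun i => S (γ i)) = O.comp G' p (fun i => S (γ' i)) := by
  subst h
  obtain rfl : G = G' := Equiv.ext fun ⟨i, v⟩ => hG i v v HEq.rfl
  rfl

/-- The axiom `assoc` needs innermost arities of the literal form `b (e ⟨i, x⟩)`. Here the innermost
operations are selected from a family over `W` by an index that equals `δ (e ⟨i, x⟩)` only
propositionally, which is why inputs are compared by `HEq`. -/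
theorem assoc_index {k l r : ℕ} {a c : Fin k → ℕ} {W : Type*} {b : W → ℕ}
    (S : ∀ w, O.Op (b w)) (e : (Σ i, Fin (a i)) ≃ Fin l) (δ : Fin l → W)
    {γ : ∀ i, Fin (a i) → W} (h : γ = fun i x => δ (e ⟨i, x⟩))
    (f : ∀ i, (Σ x, Fin (b (γ i x))) ≃ Fin (c i)) (g : (Σ i, Fin (c i)) ≃ Fin r)
    (G : (Σ x, Fin (b (δ x))) ≃ Fin r)
    (hG : ∀ i x v v', HEq v v' → G ⟨e ⟨i, x⟩, v⟩ = g ⟨i, f i ⟨x, v'⟩⟩)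
    (p : O.Op k) (q : ∀ i, O.Op (a i)) :
    O.comp g p (fun i => O.comp (f i) (q i) (fun x => S (γ i x))) =
      O.comp G (O.comp e p q) (fun x => S (δ x)) := by
  subst h
  rw [O.assoc e f g p q (fun x => S (δ x))]
  congr 1
  ext ⟨y, v⟩ : 1
  obtain ⟨⟨i, x⟩, rfl⟩ := e.surjective y
  rw [hG i x v v HEq.rfl]
  have : (Equiv.sigmaCongrLeft (β := fun x => Fin (b (δ x))) e).symm ⟨e ⟨i, x⟩, v⟩ =
      ⟨⟨i, x⟩, v⟩ := by
    rw [Equiv.symm_apply_eq]; rfl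
  simp only [Equiv.trans_apply, this]
  rfl

/-- Associativity for a doubly indexed family of innermost operations. -/
theorem assoc_family {k l r : ℕ} {a c : Fin k → ℕ} {b : ∀ i, Fin (a i) → ℕ}
    (e : (Σ i, Fin (a i)) ≃ Fin l) (f : ∀ i, (Σ x, Fin (b i x)) ≃ Fin (c i))
    (g : (Σ i, Fin (c i)) ≃ Fin r)
    (G : (Σ x, Fin (b (e.symm x).1 (e.symm x).2)) ≃ Fin r)
    (hG : ∀ x v, G ⟨x, v⟩ = g ⟨(e.symm x).1, f _ ⟨(e.symm x).2, v⟩⟩)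
    (p : O.Op k) (q : ∀ i, O.Op (a i)) (s : ∀ i x, O.Op (b i x)) :
    O.comp g p (fun i => O.comp (f i) (q i) (s i)) =
      O.comp G (O.comp e p q) (fun x => s (e.symm x).1 (e.symm x).2) := by
  -- The index set consists of the pairs `⟨i, x⟩`. The nested side uses the pair itself, the flat
  -- side recovers it through `e.symm`.
  refine O.assoc_index (W := Σ i, Fin (a i)) (b := fun w => b w.1 w.2) (fun w => s w.1 w.2) e
    e.symm (γ := fun i x => ⟨i, x⟩) (by simp) f g G ?_ p q
  have key : ∀ (w w' : Σ i, Fin (a i)), w = w' → ∀ (v : Fin (b w.1 w.2)) (v' : Fin (b w'.1 w'.2)),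
      HEq v v' → g ⟨w.1, f _ ⟨w.2, v⟩⟩ = g ⟨w'.1, f _ ⟨w'.2, v'⟩⟩ := by
    rintro w _ rfl v _ ⟨⟩
    rfl
  intro i x v v' hv
  rw [hG]
  exact key _ ⟨i, x⟩ (e.symm_apply_apply _) v v' hv

/-- If two two-level composites agree up to the bijection `w` of their inputs, then a three-level
composite over the first one can be regrouped as a three-level composite over the second one. -/
theorem exists_regroup {k k' l r : ℕ} {a c : Fin k → ℕ} {a' : Fin k' → ℕ}
    {b : ∀ i, Fin (a i) → ℕ} {p : O.Op k} {q : ∀ i, O.Op (a i)} {p' : O.Op k'}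
    {q' : ∀ i, O.Op (a' i)} (w : (Σ i, Fin (a' i)) ≃ Σ i, Fin (a i))
    (g : (Σ i, Fin (a i)) ≃ Fin l) (h : O.comp g p q = O.comp (w.trans g) p' q')
    (f : ∀ i, (Σ x, Fin (b i x)) ≃ Fin (c i)) (e : (Σ i, Fin (c i)) ≃ Fin r)
    (s : ∀ i x, O.Op (b i x)) :
    ∃ (c' : Fin k' → ℕ) (t : ∀ i, O.Op (c' i)) (e' : (Σ i, Fin (c' i)) ≃ Fin r),
      O.comp e p (fun i => O.comp (f i) (q i) (s i)) = O.comp e' p' t ∧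
      ∀ u, ∃ x v, e' u = e ⟨(w ⟨u.1, x⟩).1, f _ ⟨(w ⟨u.1, x⟩).2, v⟩⟩ := by
  let b' : ∀ i, Fin (a' i) → ℕ := fun i x => b (w ⟨i, x⟩).1 (w ⟨i, x⟩).2
  let f' : ∀ i, (Σ x, Fin (b' i x)) ≃ Fin (∑ x, b' i x) := fun i => finSigmaFinEquiv
  let B : (Σ i, Fin (a i)) → Type := fun y => Fin (b y.1 y.2)
  -- An innermost input `v` at the position `⟨i, x⟩` of the new grouping is the input `v` at the
  -- position `w ⟨i, x⟩` of the old one.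
  let e' : (Σ i, Fin (∑ x, b' i x)) ≃ Fin r :=
    (Equiv.sigmaCongrRight f').symm.trans ((Equiv.sigmaAssoc fun i x => Fin (b' i x)).symm.trans
      ((Equiv.sigmaCongrLeft (β := B) w).trans ((Equiv.sigmaAssoc fun i x => Fin (b i x)).trans
        ((Equiv.sigmaCongrRight f).trans e))))
  have he' : ∀ i x v, e' ⟨i, f' i ⟨x, v⟩⟩ = e ⟨(w ⟨i, x⟩).1, f _ ⟨(w ⟨i, x⟩).2, v⟩⟩ := by
    intro i x v
    have : (Equiv.sigmaCongrRight f').symm ⟨i, f' i ⟨x, v⟩⟩ = ⟨i, x, v⟩ := by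
      rw [Equiv.symm_apply_eq]; rfl
    simp only [e', Equiv.trans_apply, this]
    rfl
  refine ⟨fun i => ∑ x, b' i x,
    fun i => O.comp (f' i) (q' i) (fun x => s (w ⟨i, x⟩).1 (w ⟨i, x⟩).2), e', ?_, ?_⟩
  -- Associativity flattens both sides to composites over the outer two levels, which agree by `h`.
  -- Only the indexing of the innermost operations remains to be compared.
  · let G : (Σ x, Fin (b (g.symm x).1 (g.symm x).2)) ≃ Fin r :=
      (Equiv.sigmaCongrLeft (β := B) g.symm).trans ((Equiv.sigmaAssoc fun i x => Fin (b i x)).trans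
        ((Equiv.sigmaCongrRight f).trans e))
    let B' : (Σ i, Fin (a' i)) → Type := fun y => Fin (b' y.1 y.2)
    let G' : (Σ x, Fin (b' ((w.trans g).symm x).1 ((w.trans g).symm x).2)) ≃ Fin r :=
      (Equiv.sigmaCongrLeft (β := B') (w.trans g).symm).trans
        ((Equiv.sigmaAssoc fun i x => Fin (b' i x)).trans ((Equiv.sigmaCongrRight f').trans e'))
    rw [O.assoc_family g f e G (fun _ _ => rfl) p q s,
      O.assoc_family (w.trans g) f' e' G' (fun _ _ => rfl) p' q'
        (fun i x => s (w ⟨i, x⟩).1 (w ⟨i, x⟩).2), ← h]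
    have key : ∀ (y y' : Σ i, Fin (a i)), y = y' → ∀ (v : Fin (b y.1 y.2))
        (v' : Fin (b y'.1 y'.2)), HEq v v' → e ⟨y.1, f _ ⟨y.2, v⟩⟩ = e ⟨y'.1, f _ ⟨y'.2, v'⟩⟩ := by
      rintro y _ rfl v _ ⟨⟩
      rfl
    refine O.comp_congr_index (W := Σ i, Fin (a i)) (b := fun y => b y.1 y.2) (fun y => s y.1 y.2)
      (γ := fun x => g.symm x) (γ' := fun x => w ((w.trans g).symm x)) (by simp) G G' ?_ _
    intro x v v' hv
    refine (key _ _ ?_ v v' hv).trans (he' _ _ v').symm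
    simp
  · rintro ⟨i, u⟩
    obtain ⟨⟨x, v⟩, rfl⟩ := (f' i).surjective u
    exact ⟨x, v, he' i x v⟩

/-- Composition with the unit on the left, for a family indexed by `Fin 1`. -/
theorem one_comp_family {l : ℕ} {a : Fin 1 → ℕ} (e : (Σ i, Fin (a i)) ≃ Fin l)
    (q : ∀ i, O.Op (a i)) :
    O.comp e O.one q = O.relabel ((Equiv.uniqueSigma fun i => Fin (a i)).symm.trans e) (q 0) := by
  obtain ⟨c, rfl⟩ : ∃ c, a = fun _ => c := ⟨a 0, funext fun i => by rw [Subsingleton.elim i 0]⟩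
  obtain ⟨q, rfl⟩ : ∃ q' : O.Op c, q = fun _ => q' :=
    ⟨q 0, funext fun i => by rw [Subsingleton.elim i 0]⟩
  exact O.one_comp e q

/-- Bijections between sums that respect the index are fibrewise. -/
theorem exists_eq_sigmaCongrRight {ι : Type*} {A B : ι → Type*} (e : (Σ i, A i) ≃ Σ i, B i)
    (h : ∀ u, (e u).1 = u.1) : ∃ ε : ∀ i, A i ≃ B i, e = Equiv.sigmaCongrRight ε := by
  have h1 : ∀ i x, ∃ y : B i, e ⟨i, x⟩ = ⟨i, y⟩ := by
    intro i x
    have := h ⟨i, x⟩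
    rcases he : e ⟨i, x⟩ with ⟨i', y⟩
    rw [he] at this
    obtain rfl : i' = i := this
    exact ⟨y, rfl⟩
  choose φ hφ using h1
  have hb : ∀ i, Function.Bijective (φ i) := by
    refine fun i => ⟨fun x y hxy => ?_, fun y => ?_⟩
    · have : e ⟨i, x⟩ = e ⟨i, y⟩ := by rw [hφ, hφ, hxy]
      simpa using e.injective this
    · obtain ⟨⟨i', x⟩, hx⟩ := e.surjective ⟨i, y⟩
      obtain rfl : i = i' := by
        have := h ⟨i', x⟩
        rwa [hx] at this
      rw [hφ] at hx
      exact ⟨x, by simpa using hx⟩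
  exact ⟨fun i => Equiv.ofBijective (φ i) (hb i), Equiv.ext fun ⟨i, x⟩ => hφ i x⟩

end SymOperad

/-! ### Inclusion, overlap and intersection of little cubes -/

namespace LittleCube

variable {n : ℕ}

/-- Inclusion of little cubes. -/
def Le (c d : LittleCube n) : Prop := ∀ i, d.lo i ≤ c.lo i ∧ c.hi i ≤ d.hi i

/-- Two little cubes overlap if their open cubes intersect. -/
def Overlap (c d : LittleCube n) : Prop := ∀ i, max (c.lo i) (d.lo i) < min (c.hi i) (d.hi i)

theorem lo_lt_hi (c : LittleCube n) (i : Fin n) : c.lo i < c.hi i := (c.2 i).2.1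

theorem lo_comp_apply (c d : LittleCube n) (i : Fin n) :
    (c.comp d).lo i = c.lo i + (c.hi i - c.lo i) * d.lo i := rfl

theorem hi_comp_apply (c d : LittleCube n) (i : Fin n) :
    (c.comp d).hi i = c.lo i + (c.hi i - c.lo i) * d.hi i := rfl

/-- The embedding of `c` is strictly increasing in every coordinate. -/
theorem comp_le_comp_iff {c d d' : LittleCube n} : Le (c.comp d) (c.comp d') ↔ Le d d' := by
  refine forall_congr' fun i => ?_
  simp only [lo_comp_apply, hi_comp_apply, add_le_add_iff_left,
    mul_le_mul_iff_right₀ (sub_pos.2 (c.lo_lt_hi i))]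

theorem Le.antisymm {c d : LittleCube n} (h : Le c d) (h' : Le d c) : c = d :=
  LittleCube.ext (fun i => le_antisymm (h' i).1 (h i).1) (fun i => le_antisymm (h i).2 (h' i).2)

theorem Le.refl (c : LittleCube n) : Le c c := fun _ => ⟨le_rfl, le_rfl⟩

theorem comp_left_cancel {c d d' : LittleCube n} (h : c.comp d = c.comp d') : d = d' :=
  ((comp_le_comp_iff (c := c)).1 (by rw [h]; exact Le.refl _)).antisymm
    ((comp_le_comp_iff (c := c)).1 (by rw [h]; exact Le.refl _))

theorem le_id (c : LittleCube n) : Le c (id n) := fun i => ⟨(c.2 i).1, (c.2 i).2.2⟩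

theorem comp_le (c d : LittleCube n) : Le (c.comp d) c := by
  have h : Le (c.comp d) (c.comp (id n)) := comp_le_comp_iff.2 d.le_id
  rwa [comp_id] at h

theorem mem_image_iff {c : LittleCube n} {x : Fin n → ℝ} :
    x ∈ c.image ↔ ∀ i, c.lo i < x i ∧ x i < c.hi i := by
  constructor
  · rintro ⟨y, hy, rfl⟩ i
    have h := c.lo_lt_hi i
    obtain ⟨h4, h5⟩ := hy i trivial
    simp only [embed]
    exact ⟨by nlinarith, by nlinarith⟩
  · intro h
    refine ⟨fun i => (x i - c.lo i) / (c.hi i - c.lo i), fun i _ => ?_, funext fun i => ?_⟩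
    · have h0 := sub_pos.2 (c.lo_lt_hi i)
      exact ⟨div_pos (sub_pos.2 (h i).1) h0,
        (div_lt_one h0).2 (sub_lt_sub_right (h i).2 _)⟩
    · have h0 := (sub_pos.2 (c.lo_lt_hi i)).ne'
      simp only [embed]
      field_simp
      ring

theorem image_mono {c d : LittleCube n} (h : Le c d) : c.image ⊆ d.image := fun _ hx =>
  mem_image_iff.2 fun i =>
    ⟨(h i).1.trans_lt (mem_image_iff.1 hx i).1, (mem_image_iff.1 hx i).2.trans_le (h i).2⟩

theorem image_nonempty (c : LittleCube n) : c.image.Nonempty :=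
  ⟨_, fun _ => 1 / 2, fun _ _ => by norm_num, rfl⟩

theorem Overlap.symm {c d : LittleCube n} (h : Overlap c d) : Overlap d c := fun i => by
  rw [max_comm, min_comm]
  exact h i

theorem Le.overlap {c d d' : LittleCube n} (h : Le c d) (h' : Le c d') : Overlap d d' := fun i =>
  (max_le (h i).1 (h' i).1).trans_lt ((c.lo_lt_hi i).trans_le (le_min (h i).2 (h' i).2))

/-- A little cube inside `c` factors through `c`. -/
theorem Le.exists_comp {c d : LittleCube n} (h : Le d c) : ∃ e, c.comp e = d := by
  have h0 : ∀ i, 0 < c.hi i - c.lo i := fun i => sub_pos.2 (c.lo_lt_hi i)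
  have key : ∀ i (t : ℝ), c.lo i + (c.hi i - c.lo i) * ((t - c.lo i) / (c.hi i - c.lo i)) = t :=
    fun i t => by rw [mul_div_cancel₀ _ (h0 i).ne', add_sub_cancel]
  -- The factor has the corners of `d`, expressed in the affine coordinates of `c`.
  have h1 : ∀ i, 0 ≤ (d.lo i - c.lo i) / (c.hi i - c.lo i) ∧
      (d.lo i - c.lo i) / (c.hi i - c.lo i) < (d.hi i - c.lo i) / (c.hi i - c.lo i) ∧
      (d.hi i - c.lo i) / (c.hi i - c.lo i) ≤ 1 := fun i =>
    ⟨div_nonneg (sub_nonneg.2 (h i).1) (h0 i).le,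
      div_lt_div_of_pos_right (sub_lt_sub_right (d.lo_lt_hi i) _) (h0 i),
      (div_le_one (h0 i)).2 (sub_le_sub_right (h i).2 _)⟩
  exact ⟨⟨(_, _), h1⟩, LittleCube.ext (fun i => key i _) (fun i => key i _)⟩

/-- The intersection of two overlapping little cubes. -/
def inter (c d : LittleCube n) (h : Overlap c d) : LittleCube n :=
  ⟨(fun i => max (c.lo i) (d.lo i), fun i => min (c.hi i) (d.hi i)), fun i =>
    ⟨(c.2 i).1.trans (le_max_left _ _), h i, (min_le_left _ _).trans (c.2 i).2.2⟩⟩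

theorem inter_le_left {c d : LittleCube n} (h : Overlap c d) : Le (inter c d h) c :=
  fun _ => ⟨le_max_left _ _, min_le_left _ _⟩

theorem inter_le_right {c d : LittleCube n} (h : Overlap c d) : Le (inter c d h) d :=
  fun _ => ⟨le_max_right _ _, min_le_right _ _⟩

theorem le_inter {c d e : LittleCube n} (h : Overlap c d) (h1 : Le e c) (h2 : Le e d) :
    Le e (inter c d h) :=
  fun i => ⟨max_le (h1 i).1 (h2 i).1, le_min (h1 i).2 (h2 i).2⟩

theorem inter_comm {c d : LittleCube n} (h : Overlap c d) : inter c d h = inter d c h.symm :=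
  (le_inter _ (inter_le_right h) (inter_le_left h)).antisymm
    (le_inter _ (inter_le_right h.symm) (inter_le_left h.symm))

/-- The intersection of `c` with an overlapping cube `d`, in the coordinates of `c`. -/
noncomputable def rel (c d : LittleCube n) (h : Overlap c d) : LittleCube n :=
  (inter_le_left h).exists_comp.choose

theorem comp_rel {c d : LittleCube n} (h : Overlap c d) : c.comp (rel c d h) = inter c d h :=
  (inter_le_left h).exists_comp.choose_spec

end LittleCube

/-! ### Restriction and common refinement of configurations -/

namespace CubeConfig

open LittleCube

variable {n : ℕ}

/-- The number of cubes of a configuration that overlap a given cube. -/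
noncomputable def overlapCard {k : ℕ} (c : LittleCube n) (p : CubeConfig n k) : ℕ :=
  Nat.card {i // Overlap c (p.1 i)}

/-- Enumeration of the cubes of a configuration that overlap a given cube. -/
noncomputable def overlapEquiv {k : ℕ} (c : LittleCube n) (p : CubeConfig n k) :
    Fin (overlapCard c p) ≃ {i // Overlap c (p.1 i)} :=
  (Finite.equivFin _).symm

/-- The restriction of a configuration to a cube, in the coordinates of that cube. -/
noncomputable def restrict {k : ℕ} (c : LittleCube n) (p : CubeConfig n k) :
    CubeConfig n (overlapCard c p) :=
  ⟨fun x => rel c (p.1 (overlapEquiv c p x)) (overlapEquiv c p x).2, fun x y hxy => by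
    -- After applying the embedding of `c`, the cubes are intersections of `c` with distinct cubes
    -- of `p`.
    refine (Set.disjoint_image_iff c.embed_injective).1 ?_
    rw [← image_comp, ← image_comp, comp_rel, comp_rel]
    refine Disjoint.mono (image_mono (inter_le_right _)) (image_mono (inter_le_right _)) (p.2 ?_)
    exact fun h => hxy ((overlapEquiv c p).injective (Subtype.ext h))⟩

theorem comp_restrict {k : ℕ} (c : LittleCube n) (p : CubeConfig n k) (x : Fin (overlapCard c p)) :
    c.comp ((restrict c p).1 x) =
      inter c (p.1 (overlapEquiv c p x)) (overlapEquiv c p x).2 :=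
  comp_rel _

/-- The overlapping pairs of cubes in two configurations. -/
noncomputable def overlapSwap {k k' : ℕ} (p : CubeConfig n k) (p' : CubeConfig n k') :
    (Σ i, Fin (overlapCard (p.1 i) p')) ≃ Σ i, Fin (overlapCard (p'.1 i) p) :=
  (Equiv.sigmaCongrRight fun i => overlapEquiv (p.1 i) p').trans
    (Equiv.trans
      { toFun := fun u => ⟨u.2.1, u.1, u.2.2.symm⟩
        invFun := fun u => ⟨u.2.1, u.1, u.2.2.symm⟩
        left_inv := fun _ => rfl
        right_inv := fun _ => rfl }
      (Equiv.sigmaCongrRight fun i => overlapEquiv (p'.1 i) p).symm)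

/-- Swapping an overlapping pair remembers its member in `p`; this tracks the cube of `p` in which a
piece of the common refinement lies. -/
theorem overlapEquiv_overlapSwap {k k' : ℕ} (p : CubeConfig n k) (p' : CubeConfig n k')
    (u : Σ i, Fin (overlapCard (p.1 i) p')) :
    (overlapEquiv (p'.1 (overlapSwap p p' u).1) p (overlapSwap p p' u).2 : Fin k) = u.1 := by
  exact congrArg Subtype.val
    ((overlapEquiv (p'.1 (overlapEquiv (p.1 u.1) p' u.2).1) p).apply_symm_apply
      ⟨u.1, (overlapEquiv (p.1 u.1) p' u.2).2.symm⟩)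

/-- The common refinement of two configurations. -/
theorem comp_restrict_comm {k k' l : ℕ} (p : CubeConfig n k) (p' : CubeConfig n k')
    (g : (Σ i, Fin (overlapCard (p'.1 i) p)) ≃ Fin l) :
    comp g p' (fun i => restrict (p'.1 i) p) =
      comp ((overlapSwap p p').trans g) p (fun i => restrict (p.1 i) p') := by
  refine Subtype.ext (funext fun x => ?_)
  obtain ⟨u, rfl⟩ := ((overlapSwap p p').trans g).surjective x
  change (p'.1 (g.symm (g (overlapSwap p p' u))).1).comp
      ((restrict (p'.1 (g.symm (g (overlapSwap p p' u))).1) p).1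
        (g.symm (g (overlapSwap p p' u))).2) =
    (p.1 (((overlapSwap p p').trans g).symm (((overlapSwap p p').trans g) u)).1).comp
      ((restrict (p.1 (((overlapSwap p p').trans g).symm (((overlapSwap p p').trans g) u)).1) p').1
        (((overlapSwap p p').trans g).symm (((overlapSwap p p').trans g) u)).2)
  -- Both sides are intersections of one cube of `p` with one of `p'`, taken in opposite orders. The
  -- indices of the cubes of `p` agree only propositionally, hence `key`.
  rw [Equiv.symm_apply_apply, Equiv.symm_apply_apply, comp_restrict, comp_restrict, inter_comm]
  have key : ∀ (i i' : Fin k) (c : LittleCube n) (h : Overlap (p.1 i) c) (h' : Overlap (p.1 i') c),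
      i = i' → inter (p.1 i) c h = inter (p.1 i') c h' := by
    rintro i _ c h h' rfl
    rfl
  exact key _ _ _ _ _ (overlapEquiv_overlapSwap p p' u)

/-- A configuration that contains the whole cube is the unit configuration. -/
theorem eq_one_of_id_le {k : ℕ} (p : CubeConfig n k) (i : Fin k) (h : Le (id n) (p.1 i)) :
    ∃ hk : k = 1, hk ▸ p = one n := by
  -- Any other cube would be a nonempty part of the unit cube, hence would meet cube `i`.
  have hu : ∀ i', i' = i := by
    intro i'
    by_contra hne
    obtain ⟨x, hx⟩ := (p.1 i').image_nonempty
    exact Set.disjoint_left.1 (p.2 hne) hx (image_mono h (image_mono (le_id _) hx))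
  obtain rfl : k = 1 := by
    have := Fintype.card_eq_one_iff.2 ⟨i, hu⟩
    simpa using this
  refine ⟨rfl, Subtype.ext (funext fun i' => ?_)⟩
  rw [hu i']
  exact (le_id _).antisymm h

end CubeConfig

/-! ### Factorization and uniqueness in operads over the little cubes -/

section CubeDirection

open LittleCube

/-- An operad `T` over the little `n`-cubes: a morphism `incl` from `C_n`, and for every operation
of `T` a family `shadow` of little `n`-cubes indexed by its inputs, compatible with composition. -/
structure CubeDirection (n : ℕ) (T : SymOperad.{u}) where
  incl : ∀ {j : ℕ}, CubeConfig n j → T.Op j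
  incl_one : incl (CubeConfig.one n) = T.one
  incl_comp : ∀ {k l : ℕ} {a : Fin k → ℕ} (e : (Σ i, Fin (a i)) ≃ Fin l) (p : CubeConfig n k)
    (q : ∀ i, CubeConfig n (a i)),
    incl (CubeConfig.comp e p q) = T.comp e (incl p) (fun i => incl (q i))
  shadow : ∀ {j : ℕ}, T.Op j → Fin j → LittleCube n
  shadow_one : ∀ x, shadow T.one x = LittleCube.id n
  shadow_relabel : ∀ {k l : ℕ} (σ : Fin k ≃ Fin l) (x : T.Op k) (y : Fin k),
    shadow (T.relabel σ x) (σ y) = shadow x y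
  shadow_comp : ∀ {k l : ℕ} {a : Fin k → ℕ} (e : (Σ i, Fin (a i)) ≃ Fin l) (x : T.Op k)
    (y : ∀ i, T.Op (a i)) (i : Fin k) (v : Fin (a i)),
    shadow (T.comp e x y) (e ⟨i, v⟩) = (shadow x i).comp (shadow (y i) v)
  shadow_incl : ∀ {j : ℕ} (p : CubeConfig n j) (x : Fin j), shadow (incl p) x = p.1 x

namespace CubeDirection

variable {n m : ℕ} {T : SymOperad.{u}}

/-- Operations transverse to the direction: they have full shadows and interchange with all
configurations. -/
def Transverse (D : CubeDirection n T) {l : ℕ} (b : T.Op l) : Prop :=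
  (∀ x, D.shadow b x = LittleCube.id n) ∧
    ∀ {k r : ℕ} (e : (Σ _ : Fin k, Fin l) ≃ Fin r) (p : CubeConfig n k),
      T.comp e (D.incl p) (fun _ => b) =
        T.comp ((SymOperad.swapIndex k l).trans e) b (fun _ => D.incl p)

/-- Operations generated by configurations and transverse operations. -/
inductive Built (D : CubeDirection n T) : ∀ {j : ℕ}, T.Op j → Prop
  | one : Built D T.one
  | relabel {k l : ℕ} (σ : Fin k ≃ Fin l) {x : T.Op k} : Built D x → Built D (T.relabel σ x)
  | comp_incl {k l : ℕ} {a : Fin k → ℕ} (e : (Σ i, Fin (a i)) ≃ Fin l) (p : CubeConfig n k)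
      {t : ∀ i, T.Op (a i)} : (∀ i, Built D (t i)) → Built D (T.comp e (D.incl p) t)
  | comp_transverse {k l : ℕ} {a : Fin k → ℕ} (e : (Σ i, Fin (a i)) ≃ Fin l) {b : T.Op k}
      (hb : D.Transverse b) {t : ∀ i, T.Op (a i)} :
      (∀ i, Built D (t i)) → Built D (T.comp e b t)

/-- An operation all of whose cubes lie over the cubes of a configuration `p` factors
through `p`. -/
theorem Built.exists_comp_incl {D : CubeDirection n T} {j : ℕ} {x : T.Op j} (hx : D.Built x) :
    ∀ {k : ℕ} (p : CubeConfig n k) (f : Fin j → Fin k), (∀ u, Le (D.shadow x u) (p.1 (f u))) →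
      ∃ (a : Fin k → ℕ) (y : ∀ i, T.Op (a i)) (e : (Σ i, Fin (a i)) ≃ Fin j),
        x = T.comp e (D.incl p) y ∧ ∀ u, f (e u) = u.1 := by
  induction hx with
  | one =>
    intro k p f hf
    -- The only shadow of the unit is the full cube, so `p` is the unit configuration.
    obtain ⟨rfl, hp⟩ := p.eq_one_of_id_le (f 0) (D.shadow_one 0 ▸ hf 0)
    dsimp only at hp
    subst hp
    refine ⟨fun _ => 1, fun _ => T.one, Equiv.uniqueSigma fun _ : Fin 1 => Fin 1, ?_,
      fun _ => Subsingleton.elim _ _⟩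
    rw [D.incl_one, T.one_comp, Equiv.symm_trans_self, T.relabel_refl]
  | relabel σ _ ih =>
    intro k p f hf
    obtain ⟨a, y, e, rfl, he⟩ := ih p (fun u => f (σ u)) fun u => D.shadow_relabel σ _ u ▸ hf (σ u)
    exact ⟨a, y, e.trans σ, T.relabel_comp _ _ _ _, he⟩
  | @comp_incl k' l z e₀ p' t _ ih =>
    intro k p f hf
    have hle : ∀ i v, Le ((p'.1 i).comp (D.shadow (t i) v)) (p.1 (f (e₀ ⟨i, v⟩))) := by
      intro i v
      rw [← D.shadow_incl p' i, ← D.shadow_comp]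
      exact hf _
    have hov : ∀ i v, Overlap (p'.1 i) (p.1 (f (e₀ ⟨i, v⟩))) :=
      fun i v => (comp_le _ _).overlap (hle i v)
    -- The cube of `p` assigned to the input `v` of `t i` overlaps `p'.1 i`; `φ` is its number in
    -- the restriction of `p`. The induction hypothesis applies to this restriction, with `φ` in
    -- place of `f`.
    let φ : ∀ i, Fin (z i) → Fin (CubeConfig.overlapCard (p'.1 i) p) :=
      fun i v => (CubeConfig.overlapEquiv (p'.1 i) p).symm ⟨_, hov i v⟩
    have hφ : ∀ i v, CubeConfig.overlapEquiv (p'.1 i) p (φ i v) = ⟨_, hov i v⟩ :=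
      fun i v => Equiv.apply_symm_apply _ _
    have key : ∀ i v, Le (D.shadow (t i) v) ((CubeConfig.restrict (p'.1 i) p).1 (φ i v)) := by
      intro i v
      rw [← comp_le_comp_iff (c := p'.1 i), CubeConfig.comp_restrict]
      refine le_inter _ (comp_le _ _) ?_
      rw [hφ]
      exact hle i v
    choose a y e ht he using fun i => ih i (CubeConfig.restrict (p'.1 i) p) (φ i) (key i)
    -- With every `t i` factored, the operation is a composite over the common refinement grouped by
    -- `p'`; it is now grouped by `p`.
    obtain ⟨c', t', e', hx, h'⟩ := T.exists_regroup (CubeConfig.overlapSwap p p') finSigmaFinEquiv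
      (p := D.incl p') (q := fun i => D.incl (CubeConfig.restrict (p'.1 i) p))
      (p' := D.incl p) (q' := fun i => D.incl (CubeConfig.restrict (p.1 i) p'))
      (by rw [← D.incl_comp, ← D.incl_comp, CubeConfig.comp_restrict_comm]) e e₀ y
    refine ⟨c', t', e', ?_, fun u => ?_⟩
    · rw [← hx, ← funext ht]
    · obtain ⟨x, v, huv⟩ := h' u
      -- By `he`, the piece containing this input is the one numbered by the swapped pair, and its
      -- cube of `p` is `u.1`.
      have h1 := congrArg Subtype.val (hφ _ (e _ ⟨(CubeConfig.overlapSwap p p' ⟨u.1, x⟩).2, v⟩))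
      rw [he] at h1
      rw [huv]
      exact h1.symm.trans (CubeConfig.overlapEquiv_overlapSwap p p' ⟨u.1, x⟩)
  | @comp_transverse k' l z e₀ b hb t _ ih =>
    intro k p f hf
    -- The full shadows of `b` leave the shadows of `t i` unchanged, so `t i` lies over `p` itself.
    have key : ∀ i v, Le (D.shadow (t i) v) (p.1 (f (e₀ ⟨i, v⟩))) := by
      intro i v
      rw [← id_comp (D.shadow (t i) v), ← hb.1 i, ← D.shadow_comp]
      exact hf _
    choose a y e ht he using fun i => ih i p (fun v => f (e₀ ⟨i, v⟩)) (key i)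
    -- Interchange turns `b` followed by copies of `p` into `p` followed by copies of `b`.
    obtain ⟨c', t', e', hx, h'⟩ := T.exists_regroup (SymOperad.swapIndex k' k) finSigmaFinEquiv
      (p := b) (q := fun _ => D.incl p) (p' := D.incl p) (q' := fun _ => b)
      (by rw [hb.2]; rfl) e e₀ y
    refine ⟨c', t', e', ?_, fun u => ?_⟩
    · rw [← hx, ← funext ht]
    · obtain ⟨x, v, huv⟩ := h' u
      rw [huv, he]
      rfl

/-- Grafting onto a configuration that contains the whole cube is a relabelling. -/
theorem comp_incl_of_id_le (D : CubeDirection n T) {k l : ℕ} {a : Fin k → ℕ}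
    (e : (Σ i, Fin (a i)) ≃ Fin l) (p : CubeConfig n k) (t : ∀ i, T.Op (a i)) (i : Fin k)
    (h : Le (LittleCube.id n) (p.1 i)) :
    ∃ σ : Fin (a i) ≃ Fin l, T.comp e (D.incl p) t = T.relabel σ (t i) := by
  obtain ⟨rfl, hp⟩ := p.eq_one_of_id_le i h
  dsimp only at hp
  subst hp
  obtain rfl : i = 0 := Subsingleton.elim _ _
  rw [D.incl_one, T.one_comp_family]
  exact ⟨_, rfl⟩

/-- The operation is the only one with its shadows in the two directions. -/
def Determined (D : CubeDirection n T) (E : CubeDirection m T) {j : ℕ} (x : T.Op j) : Prop :=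
  ∀ x', D.shadow x' = D.shadow x → E.shadow x' = E.shadow x → x' = x

theorem Determined.symm {D : CubeDirection n T} {E : CubeDirection m T} {j : ℕ} {x : T.Op j}
    (h : D.Determined E x) : E.Determined D x := fun x' h1 h2 => h x' h2 h1

theorem Determined.relabel {D : CubeDirection n T} {E : CubeDirection m T} {k l : ℕ}
    (σ : Fin k ≃ Fin l) {x : T.Op k} (h : D.Determined E x) :
    D.Determined E (T.relabel σ x) := by
  intro x' h1 h2
  obtain ⟨x', rfl⟩ : ∃ x'', T.relabel σ x'' = x' :=
    ⟨T.relabel σ.symm x', by rw [T.relabel_relabel, Equiv.symm_trans_self, T.relabel_refl]⟩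
  rw [h x' (funext fun u => ?_) (funext fun u => ?_)]
  · rw [← D.shadow_relabel σ, ← D.shadow_relabel σ, h1]
  · rw [← E.shadow_relabel σ, ← E.shadow_relabel σ, h2]

/-- A competitor has its `D`-shadows inside the cubes of `p`, so it factors through `p` with the
same distribution of inputs. Embeddings cancel on the left in both directions, so its pieces have
the shadows of the `t i`. -/
theorem Determined.comp_incl {D : CubeDirection n T} {E : CubeDirection m T} {k l : ℕ}
    {a : Fin k → ℕ} (hD : ∀ {j : ℕ} (x : T.Op j), D.Built x) (e : (Σ i, Fin (a i)) ≃ Fin l)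
    (p : CubeConfig n k) {t : ∀ i, T.Op (a i)} (ht : ∀ i, D.Determined E (t i)) :
    D.Determined E (T.comp e (D.incl p) t) := by
  intro x h1 h2
  obtain ⟨b, y, e', rfl, he'⟩ := (hD x).exists_comp_incl p (fun u => (e.symm u).1) (by
    intro u
    obtain ⟨⟨i, v⟩, rfl⟩ := e.surjective u
    rw [h1, D.shadow_comp, e.symm_apply_apply, D.shadow_incl]
    exact comp_le _ _)
  -- Both numberings assign each input to the same cube of `p`, so they differ by fibrewise
  -- bijections, which are absorbed into the `y i`.
  obtain ⟨ε, hε⟩ := SymOperad.exists_eq_sigmaCongrRight (e'.trans e.symm) he'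
  obtain rfl : e' = (Equiv.sigmaCongrRight ε).trans e := by
    rw [← hε, Equiv.trans_assoc, Equiv.symm_trans_self, Equiv.trans_refl]
  rw [← T.comp_relabel_right] at h1 h2 ⊢
  congr 1
  funext i
  refine ht i _ (funext fun v => ?_) (funext fun v => ?_)
  · have := congrFun h1 (e ⟨i, v⟩)
    rw [D.shadow_comp, D.shadow_comp] at this
    exact comp_left_cancel this
  · have := congrFun h2 (e ⟨i, v⟩)
    rw [E.shadow_comp, E.shadow_comp] at this
    exact comp_left_cancel this

/-- If the operation is unary and has full shadows in the two directions, then it is the unit. -/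
def UnitDetermined (D : CubeDirection n T) (E : CubeDirection m T) {j : ℕ} (x : T.Op j) : Prop :=
  -- A bijection in place of `j = 1` lets the statement range over all arities, as the induction
  -- requires.
  ∀ σ : Fin j ≃ Fin 1, (∀ u, D.shadow x u = LittleCube.id n) →
    (∀ u, E.shadow x u = LittleCube.id m) → T.relabel σ x = T.one

theorem UnitDetermined.symm {D : CubeDirection n T} {E : CubeDirection m T} {j : ℕ} {x : T.Op j}
    (h : D.UnitDetermined E x) : E.UnitDetermined D x := fun σ h1 h2 => h σ h2 h1

theorem unitDetermined_one (D : CubeDirection n T) (E : CubeDirection m T) :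
    D.UnitDetermined E T.one := fun σ _ _ => by
  rw [Subsingleton.elim σ (Equiv.refl _), T.relabel_refl]

theorem UnitDetermined.relabel {D : CubeDirection n T} {E : CubeDirection m T} {k l : ℕ}
    (σ : Fin k ≃ Fin l) {x : T.Op k} (h : D.UnitDetermined E x) :
    D.UnitDetermined E (T.relabel σ x) := by
  intro τ h1 h2
  rw [T.relabel_relabel]
  refine h _ (fun u => ?_) (fun u => ?_)
  · rw [← D.shadow_relabel σ, h1]
  · rw [← E.shadow_relabel σ, h2]

/-- The full shadow of the single input lies in a cube of `p`, so `p` is the unit and the composite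
is a relabelling of one `t i`. The `E`-shadows matter only when the roles are exchanged. -/
theorem UnitDetermined.comp_incl {D : CubeDirection n T} {E : CubeDirection m T} {k l : ℕ}
    {a : Fin k → ℕ} (e : (Σ i, Fin (a i)) ≃ Fin l) (p : CubeConfig n k) {t : ∀ i, T.Op (a i)}
    (ht : ∀ i, D.UnitDetermined E (t i)) : D.UnitDetermined E (T.comp e (D.incl p) t) := by
  intro τ h1 h2
  obtain ⟨⟨i, v⟩, -⟩ := e.surjective (τ.symm 0)
  have h := h1 (e ⟨i, v⟩)
  rw [D.shadow_comp, D.shadow_incl] at h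
  obtain ⟨σ, hσ⟩ := D.comp_incl_of_id_le e p t i (h ▸ comp_le _ _)
  rw [hσ] at h1 h2 ⊢
  exact (ht i).relabel σ τ h1 h2

theorem determined_one {D : CubeDirection n T} {E : CubeDirection m T}
    (h : ∀ x : T.Op 1, D.UnitDetermined E x) : D.Determined E T.one := by
  intro x h1 h2
  rw [← h x (Equiv.refl _) (fun u => by rw [h1, D.shadow_one]) (fun u => by rw [h2, E.shadow_one]),
    T.relabel_refl]

end CubeDirection

end CubeDirection

/-! ### Projections of little cubes and induction in the tensor product -/

namespace LittleCube

variable {n m : ℕ}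

/-- The projection of a little cube to the first coordinates. -/
def fst (c : LittleCube (n + m)) : LittleCube n :=
  ⟨(fun i => c.lo (Fin.castAdd m i), fun i => c.hi (Fin.castAdd m i)), fun _ => c.2 _⟩

/-- The projection of a little cube to the last coordinates. -/
def snd (c : LittleCube (n + m)) : LittleCube m :=
  ⟨(fun i => c.lo (Fin.natAdd n i), fun i => c.hi (Fin.natAdd n i)), fun _ => c.2 _⟩

theorem fst_prod (c : LittleCube n) (d : LittleCube m) : (c.prod d).fst = c := by
  ext i <;> simp [fst, prod, lo, hi]

theorem snd_prod (c : LittleCube n) (d : LittleCube m) : (c.prod d).snd = d := by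
  ext i <;> simp [snd, prod, lo, hi]

end LittleCube

namespace TopOperad

/-- The class of a formal expression, as an operation of the tensor product. -/
def tensorMk {P Q : TopOperad.{u}} {j : ℕ} (t : Term P Q j) : (tensorSym P Q).Op j :=
  TensorOp.mk t

theorem tensorMk_comp {P Q : TopOperad.{u}} {k l : ℕ} {a : Fin k → ℕ}
    (e : (Σ i, Fin (a i)) ≃ Fin l) (t : Term P Q k) (s : ∀ i, Term P Q (a i)) :
    tensorMk (.comp e t s) = (tensorSym P Q).comp e (tensorMk t) (fun i => tensorMk (s i)) :=
  (TensorOp.comp_mk e t s).symm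

theorem tensorMk_relabel {P Q : TopOperad.{u}} {k l : ℕ} (σ : Fin k ≃ Fin l) (t : Term P Q k) :
    tensorMk (.relabel σ t) = (tensorSym P Q).relabel σ (tensorMk t) := rfl

/-- Induction principle for the tensor product: every operation is obtained from the unit by
relabelling and by grafting onto operations of the two factors. -/
theorem tensorSym_induction {P Q : TopOperad.{u}}
    {motive : ∀ {j : ℕ}, (tensorSym P Q).Op j → Prop}
    (one : motive (tensorSym P Q).one)
    (relabel : ∀ {k l : ℕ} (σ : Fin k ≃ Fin l) {x : (tensorSym P Q).Op k}, motive x →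
      motive ((tensorSym P Q).relabel σ x))
    (comp_inl : ∀ {k l : ℕ} {a : Fin k → ℕ} (e : (Σ i, Fin (a i)) ≃ Fin l) (p : P.Op k)
      {t : ∀ i, (tensorSym P Q).Op (a i)}, (∀ i, motive (t i)) →
      motive ((tensorSym P Q).comp e (tensorMk (.inl p)) t))
    (comp_inr : ∀ {k l : ℕ} {a : Fin k → ℕ} (e : (Σ i, Fin (a i)) ≃ Fin l) (q : Q.Op k)
      {t : ∀ i, (tensorSym P Q).Op (a i)}, (∀ i, motive (t i)) →
      motive ((tensorSym P Q).comp e (tensorMk (.inr q)) t))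
    {j : ℕ} (x : (tensorSym P Q).Op j) : motive x := by
  -- Terms may nest composites on the left, so the induction on terms proves the stronger claim that
  -- grafting onto any term preserves the motive.
  have key : ∀ {k : ℕ} (t : Term P Q k) {l : ℕ} {a : Fin k → ℕ} (e : (Σ i, Fin (a i)) ≃ Fin l)
      (s : ∀ i, (tensorSym P Q).Op (a i)), (∀ i, motive (s i)) →
      motive ((tensorSym P Q).comp e (tensorMk t) s) := by
    intro k t
    induction t with
    | inl p => exact fun e s hs => comp_inl e p hs
    | inr q => exact fun e s hs => comp_inr e q hs
    | one =>
      intro l a e s hs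
      have h := (tensorSym P Q).one_comp_family e s
      change motive ((tensorSym P Q).comp e (tensorSym P Q).one s)
      rw [h]
      exact relabel _ (hs 0)
    | relabel σ t ih =>
      intro l a e s hs
      rw [tensorMk_relabel, (tensorSym P Q).comp_relabel_left σ e (tensorMk t) s]
      exact ih _ _ fun i => hs (σ i)
    | @comp k' l' a' e' t s ih ihs =>
      intro l a e r hr
      let f : ∀ i, (Σ x : Fin (a' i), Fin (a (e' ⟨i, x⟩))) ≃ Fin (∑ x, a (e' ⟨i, x⟩)) :=
        fun i => finSigmaFinEquiv
      -- Chosen so that associativity turns the right-nested composite into the given one, with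
      -- numbering `e`.
      let g : (Σ i, Fin (∑ x, a (e' ⟨i, x⟩))) ≃ Fin l :=
        (Equiv.sigmaCongrRight f).symm.trans ((Equiv.sigmaAssoc _).symm.trans
          ((Equiv.sigmaCongrLeft e').trans e))
      have hg : (Equiv.sigmaCongrLeft e').symm.trans ((Equiv.sigmaAssoc _).trans
          ((Equiv.sigmaCongrRight f).trans g)) = e := by
        refine Equiv.ext fun u => ?_
        obtain ⟨u, rfl⟩ := ((Equiv.sigmaAssoc fun i x => Fin (a (e' ⟨i, x⟩))).symm.trans
          (Equiv.sigmaCongrLeft (β := fun y => Fin (a y)) e')).surjective u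
        simp only [g, Equiv.trans_apply, Equiv.symm_apply_apply, Equiv.apply_symm_apply]
      have h := (tensorSym P Q).assoc e' f g (tensorMk t) (fun i => tensorMk (s i)) r
      rw [tensorMk_comp, ← hg, ← h]
      exact ih g _ fun i => ihs i (f i) _ fun x => hr _
  obtain ⟨t, ht⟩ := TensorOp.mk_surjective x
  change tensorMk t = x at ht
  -- Grafting units onto a representative of `x` recovers `x`.
  have h := (tensorSym P Q).comp_one (Equiv.sigmaUnique (Fin j) fun _ => Fin 1) x
  rw [Equiv.symm_trans_self, (tensorSym P Q).relabel_refl] at h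
  rw [← h, ← ht]
  exact key t _ _ fun _ => one

end TopOperad

namespace LittleCube

variable {n m : ℕ}

theorem fst_comp (c d : LittleCube (n + m)) : (c.comp d).fst = c.fst.comp d.fst := rfl

theorem snd_comp (c d : LittleCube (n + m)) : (c.comp d).snd = c.snd.comp d.snd := rfl

theorem fst_id : (id (n + m)).fst = id n := rfl

theorem snd_id : (id (n + m)).snd = id m := rfl

end LittleCube

/-! ### The two directions of `C_n ⊗ C_m` and injectivity of `μ` -/

open TopOperad

/-- The little cubes of the image in `C_{n+m}` of an operation of `C_n ⊗ C_m`. -/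
noncomputable def tensorCubes {n m j : ℕ} (x : (tensorSym (littleCubes n) (littleCubes m)).Op j) :
    Fin j → LittleCube (n + m) :=
  Subtype.val (p := fun c : Fin j → LittleCube (n + m) =>
    Pairwise fun x y => Disjoint (c x).image (c y).image) ((cubesMu n m).app j x)

section tensorCubes

variable {n m : ℕ}

theorem tensorCubes_relabel {k l : ℕ} (σ : Fin k ≃ Fin l)
    (x : (tensorSym (littleCubes n) (littleCubes m)).Op k) (u : Fin k) :
    tensorCubes ((tensorSym (littleCubes n) (littleCubes m)).relabel σ x) (σ u) =
      tensorCubes x u := by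
  have h : tensorCubes ((tensorSym (littleCubes n) (littleCubes m)).relabel σ x) (σ u) =
      tensorCubes x (σ.symm (σ u)) :=
    congrArg (fun c : CubeConfig (n + m) l => c.1 (σ u)) ((cubesMu n m).app_relabel σ x)
  rw [h, σ.symm_apply_apply]

theorem tensorCubes_comp {k l : ℕ} {a : Fin k → ℕ} (e : (Σ i, Fin (a i)) ≃ Fin l)
    (x : (tensorSym (littleCubes n) (littleCubes m)).Op k)
    (y : ∀ i, (tensorSym (littleCubes n) (littleCubes m)).Op (a i)) (i : Fin k) (v : Fin (a i)) :
    tensorCubes ((tensorSym (littleCubes n) (littleCubes m)).comp e x y) (e ⟨i, v⟩) =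
      (tensorCubes x i).comp (tensorCubes (y i) v) := by
  have h : tensorCubes ((tensorSym (littleCubes n) (littleCubes m)).comp e x y) (e ⟨i, v⟩) =
      (tensorCubes x (e.symm (e ⟨i, v⟩)).1).comp
        (tensorCubes (y (e.symm (e ⟨i, v⟩)).1) (e.symm (e ⟨i, v⟩)).2) :=
    congrArg (fun c : CubeConfig (n + m) l => c.1 (e ⟨i, v⟩)) ((cubesMu n m).app_comp e x y)
  rw [h, e.symm_apply_apply]

end tensorCubes

/-- The first factor of `C_n ⊗ C_m` as a direction of cubes. -/
noncomputable def tensorDirectionLeft (n m : ℕ) :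
    CubeDirection n (tensorSym (littleCubes n) (littleCubes m)) where
  incl {j} p := tensorMk (.inl (P := littleCubes n) (k := j) p)
  incl_one := TensorOp.sound .inl_one
  incl_comp e p q := (TensorOp.sound (.inl_comp (P := littleCubes n) e p q)).trans
    (TensorOp.comp_mk e _ _).symm
  shadow x u := (tensorCubes x u).fst
  shadow_one x := LittleCube.fst_id
  shadow_relabel σ x y := by rw [tensorCubes_relabel]
  shadow_comp e x y i v := by rw [tensorCubes_comp, LittleCube.fst_comp]
  shadow_incl p x := LittleCube.fst_prod _ _

/-- The second factor of `C_n ⊗ C_m` as a direction of cubes. -/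
noncomputable def tensorDirectionRight (n m : ℕ) :
    CubeDirection m (tensorSym (littleCubes n) (littleCubes m)) where
  incl {j} p := tensorMk (.inr (Q := littleCubes m) (k := j) p)
  incl_one := TensorOp.sound .inr_one
  incl_comp e p q := (TensorOp.sound (.inr_comp (Q := littleCubes m) e p q)).trans
    (TensorOp.comp_mk e _ _).symm
  shadow x u := (tensorCubes x u).snd
  shadow_one x := LittleCube.snd_id
  shadow_relabel σ x y := by rw [tensorCubes_relabel]
  shadow_comp e x y i v := by rw [tensorCubes_comp, LittleCube.snd_comp]
  shadow_incl p x := LittleCube.snd_prod _ _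

theorem tensor_interchange {n m k l r : ℕ} (e : (Σ _ : Fin k, Fin l) ≃ Fin r)
    (p : CubeConfig n k) (q : CubeConfig m l) :
    (tensorSym (littleCubes n) (littleCubes m)).comp e ((tensorDirectionLeft n m).incl p)
        (fun _ => (tensorDirectionRight n m).incl q) =
      (tensorSym (littleCubes n) (littleCubes m)).comp ((SymOperad.swapIndex k l).trans e)
        ((tensorDirectionRight n m).incl q) (fun _ => (tensorDirectionLeft n m).incl p) :=
  ((tensorMk_comp (P := littleCubes n) (Q := littleCubes m) e (.inl p) fun _ => .inr q).symm.trans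
    (TensorOp.sound (.interchange (P := littleCubes n) (Q := littleCubes m) e p q))).trans
      (tensorMk_comp (P := littleCubes n) (Q := littleCubes m) _ (.inr q) fun _ => .inl p)

/-- The operation `1 ⊗ q` leaves the first `n` coordinates untouched, and the interchange relation
holds by construction. -/
theorem transverse_right {n m l : ℕ} (q : CubeConfig m l) :
    (tensorDirectionLeft n m).Transverse ((tensorDirectionRight n m).incl q) :=
  ⟨fun _ => LittleCube.fst_prod _ _, fun e p => tensor_interchange e p q⟩

theorem transverse_left {n m l : ℕ} (p : CubeConfig n l) :
    (tensorDirectionRight n m).Transverse ((tensorDirectionLeft n m).incl p) :=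
  ⟨fun _ => LittleCube.snd_prod _ _, fun e q => by rw [tensor_interchange]; rfl⟩

theorem built_left {n m j : ℕ} (x : (tensorSym (littleCubes n) (littleCubes m)).Op j) :
    (tensorDirectionLeft n m).Built x :=
  tensorSym_induction (motive := fun x => (tensorDirectionLeft n m).Built x) .one
    (fun σ _ => .relabel σ) (fun e p _ => .comp_incl e p)
    (fun e q _ => .comp_transverse e (transverse_right q)) x

theorem built_right {n m j : ℕ} (x : (tensorSym (littleCubes n) (littleCubes m)).Op j) :
    (tensorDirectionRight n m).Built x :=
  tensorSym_induction (motive := fun x => (tensorDirectionRight n m).Built x) .one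
    (fun σ _ => .relabel σ) (fun e p _ => .comp_transverse e (transverse_left p))
    (fun e q _ => .comp_incl e q) x

theorem unitDetermined {n m j : ℕ} (x : (tensorSym (littleCubes n) (littleCubes m)).Op j) :
    (tensorDirectionLeft n m).UnitDetermined (tensorDirectionRight n m) x :=
  tensorSym_induction
    (motive := fun x => (tensorDirectionLeft n m).UnitDetermined (tensorDirectionRight n m) x)
    (CubeDirection.unitDetermined_one _ _) (fun σ _ h => h.relabel σ)
    (fun e p _ h => .comp_incl e p h)
    (fun e q _ h => (CubeDirection.UnitDetermined.comp_incl e q fun i => (h i).symm).symm) x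

/-- Being determined is symmetric in the two directions, so the grafting lemma, applied to each
direction in turn, covers both kinds of generators. -/
theorem determined {n m j : ℕ} (x : (tensorSym (littleCubes n) (littleCubes m)).Op j) :
    (tensorDirectionLeft n m).Determined (tensorDirectionRight n m) x :=
  tensorSym_induction
    (motive := fun x => (tensorDirectionLeft n m).Determined (tensorDirectionRight n m) x)
    (CubeDirection.determined_one unitDetermined) (fun σ _ h => h.relabel σ)
    (fun e p _ h => .comp_incl built_left e p h)
    (fun e q _ h => (CubeDirection.Determined.comp_incl built_right e q fun i => (h i).symm).symm) x

/-- The morphism `C_n ⊗ C_m → C_{n+m}` is injective in every arity. -/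
theorem cubesMu_injective (n m j : ℕ) : Function.Injective ((cubesMu n m).app j) := by
  intro x y h
  have h' : tensorCubes x = tensorCubes y := congrArg (fun c : CubeConfig (n + m) j => c.1) h
  refine determined y x (funext fun u => ?_) (funext fun u => ?_)
  · exact congrArg LittleCube.fst (congrFun h' u)
  · exact congrArg LittleCube.snd (congrFun h' u)

/-- Continuity is part of the morphism and surjectivity is the definition of the image, which leaves
`cubesMu_injective`. -/
theorem lemma2 (n m : ℕ) (hn : 1 ≤ n) (hm : 1 ≤ m) (j : ℕ) (hj : 1 ≤ j) :
    Continuous ((cubesMuRange n m).app j) ∧ Function.Bijective ((cubesMuRange n m).app j) := by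
  refine ⟨(cubesMuRange n m).continuous_app j, fun x y h => ?_, ?_⟩
  · exact cubesMu_injective n m j (congrArg Subtype.val h)
  · rintro ⟨_, x, rfl⟩
    exact ⟨x, rfl⟩
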